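/- **Setting.** Let $\mathcal W$ be a finite set of at least three words, containing two distinct special words $\langle\mathrm{BOS}\rangle$ and $\langle\mathrm{COPY}\rangle$. A left-infinite sequence is written $X=[\dots,X_{-2},X_{-1},X_0]$. All norms $\|\cdot\|_\infty$ of matrices and vectors below are the largest absolute value of an entry, and $\|\cdot\|_0$ is the number of nonzero entries. All parameters are real. * $\Psi(L,W,S,B)$ is the class of ReLU networks $f(x)=(A_L\eta(\cdot)+b_L)\circ\cdots\circ(A_1x+b_1)$, $\eta(u)=\max(u,0)$ componentwise, $A_i\in\mathbb R^{d_{i+1}\times d_i}$, $b_i\in\mathbb R^{d_{i+1}}$, with $L\ge1$, $\max_{1\le i\le L+1}d_i\le W$, $\max_i\max\{\|A_i\|_\infty,\|b_i\|_\infty\}\le B$ and $\sum_{i=1}^L(\|A_i\|_0+\|b_i\|_0)\le S$. * $\mathcal C(U,D,B)$ is the class of convolution layers $g$ on left-infinite sequences in $\mathbb R^D$, $$g(X)_{-i,k}=\sum_{j=0}^{U}H_{k,j}\,(Q X_{-i-j})_k,\qquad H_{k,j}=c_{1,k}\cos\Bigl(\tfrac{2\pi j a_{1,k}}{U+1}\Bigr)+c_{2,k}\sin\Bigl(\tfrac{2\pi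 j a_{2,k}}{U+1}\Bigr),$$ with $Q\in\mathbb R^{D\times D}$, $c_1,c_2,a_1,a_2\in\mathbb R^D$, all of $\|\cdot\|_\infty$-norm at most $B$. * $\mathcal S(M,U,D,L,W,S,B)$ is the class of maps $f_M\circ g_M\circ\cdots\circ f_1\circ g_1\circ\mathrm{Emb}$, where $f_i\in\Psi(L,W,S,B)$ maps $\mathbb R^D$ to $\mathbb R^D$ and is applied to each token separately, $g_i\in\mathcal C(U,D,B)$, and $\mathrm{Emb}(X)_{-i}=E_1X_{-i}+E_2$ with $E_1\in\mathbb R^{D\times|\mathcal W|}$, $E_2\in\mathbb R^D$, $\|E_1\|_\infty,\|E_2\|_\infty\le B$. A finite sequence of words is fed to $F\in\mathcal S(M,U,D,L,W,S,B)$ as the sequence of its one-hot vectors in $\mathbb R^{|\mathcal W|}$, with the last word at position $0$ and zero vectors before the first word. With a decoding matrix $W_{\mathrm{dec}}\in\mathbb R^{D\times|\mathcal W|}$, the predicted next word is the one with the largest component of $W_{\mathrm{dec}}^\top F(X)_0$ (a tie for the largest component counts as a failure). The model generates words autoregressively: each predicted word is appended to the input before the next prediction. For $n\ge1$, let $x_1,\dots,x_n$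 be independent and uniformly distributed on $\mathcal W\setminus\{\langle\mathrm{BOS}\rangle,\langle\mathrm{COPY}\rangle\}$, let $y_1,\dots,y_n$ be the first $n$ words generated by the model from the input $\langle\mathrm{BOS}\rangle\,x_1\cdots x_n\,\langle\mathrm{COPY}\rangle$, and put $\mathrm{err}_n=\mathbb P[(y_1,\dots,y_n)\ne(x_1,\dots,x_n)]$. **Theorem.** There is a universal constant $C>0$ such that for every $\mathcal W$ as above, every $\epsilon>0$ and every integer $V\ge1$ there are $D,L,W,S\in\mathbb N$ and $B>0$ with $$D,\ L,\ W,\ S,\ \log B\ \le\ C\,\bigl(\max\{1,\log\epsilon^{-1}\}\bigr)^{37}\,\bigl(\max\{1,\log V\}\bigr)^{42}\,\log^{8}|\mathcal W| ,$$ an SSM $\hat F\in\mathcal S(M,U,D,L,W,S,B)$ with $M=2$ and $U=V$, and a decoding matrix $W_{\mathrm{dec}}$ with $\|W_{\mathrm{dec}}\|_\infty\le1$, such that $$\sup_{1\le V'\le V}\mathrm{err}_{V'}\le\epsilon .$$ -/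

import Mathlib

open MeasureTheory

noncomputable section

namespace SSM

/-! ### Feed-forward layers -/

/-- Parameters of a ReLU network with `L ≥ 1` affine maps, input dimension `m` and output
dimension `n`.  The first affine map is applied to the input itself, each further one after the
componentwise ReLU. -/
inductive FNN : ℕ → ℕ → ℕ → Type
  | affine {m n : ℕ} (A : Matrix (Fin n) (Fin m) ℝ) (b : Fin n → ℝ) : FNN 1 m n
  | comp {L m k n : ℕ} (f : FNN L m k) (A : Matrix (Fin n) (Fin k) ℝ) (b : Fin n → ℝ) :
      FNN (L + 1) m n

/-- The function `x ↦ (A_L η(·) + b_L) ∘ ⋯ ∘ (A_1 x + b_1)` with `η = ReLU`. -/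
def FNN.eval : {L m n : ℕ} → FNN L m n → (Fin m → ℝ) → (Fin n → ℝ)
  | _, _, _, .affine A b, x => A.mulVec x + b
  | _, _, _, .comp f A b, x => A.mulVec (fun k => max (f.eval x k) 0) + b

/-- The largest of all the layer dimensions (input and output included). -/
def FNN.width : {L m n : ℕ} → FNN L m n → ℕ
  | _, m, n, .affine _ _ => max m n
  | _, _, n, .comp f _ _ => max f.width n

/-- Number of nonzero entries of a matrix. -/
def matNnz {m n : ℕ} (A : Matrix (Fin n) (Fin m) ℝ) : ℕ :=
  Nat.card {p : Fin n × Fin m // A p.1 p.2 ≠ 0}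

/-- Number of nonzero entries of a vector. -/
def vecNnz {n : ℕ} (b : Fin n → ℝ) : ℕ :=
  Nat.card {i : Fin n // b i ≠ 0}

/-- Total number of nonzero weights and biases. -/
def FNN.nnz : {L m n : ℕ} → FNN L m n → ℕ
  | _, _, _, .affine A b => matNnz A + vecNnz b
  | _, _, _, .comp f A b => f.nnz + (matNnz A + vecNnz b)

/-- All weights and biases have absolute value at most `B`. -/
def FNN.BoundedBy (B : ℝ) : {L m n : ℕ} → FNN L m n → Prop
  | _, _, _, .affine A b => (∀ i j, |A i j| ≤ B) ∧ ∀ i, |b i| ≤ B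
  | _, _, _, .comp f A b => f.BoundedBy B ∧ (∀ i j, |A i j| ≤ B) ∧ ∀ i, |b i| ≤ B

/-- The class `Ψ(L, W, S, B)` of ReLU networks from `ℝ^m` to `ℝ^n` of depth `L`, width at most `W`,
at most `S` nonzero parameters and parameters bounded by `B`. -/
def fnnClass (m n L W S : ℕ) (B : ℝ) : Set ((Fin m → ℝ) → (Fin n → ℝ)) :=
  {f | ∃ φ : FNN L m n, φ.width ≤ W ∧ φ.nnz ≤ S ∧ φ.BoundedBy B ∧ f = φ.eval}

/-! ### Sequences, convolution layers, embedding

A left-infinite sequence `[…, s_{-2}, s_{-1}, s_0]` of tokens is a function on `ℕ`, whose value at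
`i` is the token at position `-i`; so `0` is the index of the last token. -/

/-- Left-infinite sequences of vectors with coordinates indexed by `ι`. -/
abbrev Seq (ι : Type*) : Type _ := ℕ → ι → ℝ

/-- The filter `H_{k,j} = c_{1,k} cos(2π j a_{1,k}/(U+1)) + c_{2,k} sin(2π j a_{2,k}/(U+1))`. -/
def convFilter {D : ℕ} (U : ℕ) (c₁ c₂ a₁ a₂ : Fin D → ℝ) (k : Fin D) (j : ℕ) : ℝ :=
  c₁ k * Real.cos (2 * Real.pi * j * a₁ k / (U + 1)) +
    c₂ k * Real.sin (2 * Real.pi * j * a₂ k / (U + 1))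

/-- The convolution layer `X ↦ H ∗ (W X)`: the output at position `-i` is computed from the tokens
at positions `-i, …, -i-U`, coordinate by coordinate. -/
def convLayer {D : ℕ} (U : ℕ) (W : Matrix (Fin D) (Fin D) ℝ) (c₁ c₂ a₁ a₂ : Fin D → ℝ)
    (X : Seq (Fin D)) : Seq (Fin D) :=
  fun i k => ∑ j ∈ Finset.range (U + 1), convFilter U c₁ c₂ a₁ a₂ k j * (W.mulVec (X (i + j))) k

/-- The class `𝒞(U, D, B)` of convolution layers with parameters bounded by `B`. -/
def convClass (U D : ℕ) (B : ℝ) : Set (Seq (Fin D) → Seq (Fin D)) :=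
  {g | ∃ (W : Matrix (Fin D) (Fin D) ℝ) (c₁ c₂ a₁ a₂ : Fin D → ℝ),
    (∀ i j, |W i j| ≤ B) ∧ (∀ k, |c₁ k| ≤ B) ∧ (∀ k, |c₂ k| ≤ B) ∧
    (∀ k, |a₁ k| ≤ B) ∧ (∀ k, |a₂ k| ≤ B) ∧ g = convLayer U W c₁ c₂ a₁ a₂}

/-- The embedding layer, `E₁ X_i + E₂` at every position. -/
def embed {ι : Type*} [Fintype ι] {D : ℕ} (E₁ : Matrix (Fin D) ι ℝ) (E₂ : Fin D → ℝ)
    (X : Seq ι) : Seq (Fin D) :=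
  fun i => E₁.mulVec (X i) + E₂

/-- The maps `f_M ∘ g_M ∘ ⋯ ∘ f_1 ∘ g_1` with `f_i ∈ Ψ(L, W, S, B)`, applied token by token, and
`g_i ∈ 𝒞(U, D, B)`. -/
def blockClass (U D L W S : ℕ) (B : ℝ) : ℕ → Set (Seq (Fin D) → Seq (Fin D))
  | 0 => {id}
  | M + 1 => {G | ∃ G' ∈ blockClass U D L W S B M, ∃ g ∈ convClass U D B,
      ∃ f ∈ fnnClass D D L W S B, G = fun X i => f (g (G' X) i)}

/-- The class `𝒮(M, U, D, L, W, S, B)` of deep networks with SSMs, on sequences of vectors with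
coordinates indexed by `ι`. -/
def ssmClass (ι : Type*) [Fintype ι] (M U D L W S : ℕ) (B : ℝ) :
    Set (Seq ι → Seq (Fin D)) :=
  {F | ∃ (E₁ : Matrix (Fin D) ι ℝ) (E₂ : Fin D → ℝ), ∃ G ∈ blockClass U D L W S B M,
    (∀ i j, |E₁ i j| ≤ B) ∧ (∀ i, |E₂ i| ≤ B) ∧ F = fun X => G (embed E₁ E₂ X)}

/-! ### Next-word prediction and generation -/

variable {α : Type*} [Fintype α] [DecidableEq α]

/-- The one-hot encoding of a finite sequence of words.  The last word stands at position `0`, and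
the positions before the first word carry the zero vector. -/
def oneHot (s : List α) : Seq α :=
  fun i => match s.reverse[i]? with
    | some w => Pi.single w 1
    | none => 0

/-- The decoder scores of the words: the matrix `Wdec` applied to the final output token. -/
def score {D : ℕ} (F : Seq α → Seq (Fin D)) (Wdec : Matrix (Fin D) α ℝ) (s : List α) (w : α) : ℝ :=
  ∑ k, Wdec k w * F (oneHot s) 0 k

open Classical in
/-- The predicted next word is the word with the largest score.  There is no prediction (`none`)
if the largest score is attained by several words. -/
def nextWord {D : ℕ} (F : Seq α → Seq (Fin D)) (Wdec : Matrix (Fin D) α ℝ) (s : List α) :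
    Option α :=
  if h : ∃ w, ∀ w', w' ≠ w → score F Wdec s w' < score F Wdec s w then some h.choose else none

/-- The first `n` words generated from the prompt `s` by autoregressive inference with the
next-word predictor `next`; `none` if some prediction fails to exist. -/
def generate (next : List α → Option α) (s : List α) : ℕ → Option (List α)
  | 0 => some []
  | n + 1 => (generate next s n).bind fun ys => (next (s ++ ys)).map fun y => ys ++ [y]

/-! ### Input copying -/

/-- The words other than the two special tokens. -/
abbrev Content (bos copy : α) : Type _ := {w : α // w ≠ bos ∧ w ≠ copy}

/-- The uniform distribution on the words other than the special tokens. -/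
def uniformContent (bos copy : α) : @Measure (Content bos copy) ⊤ :=
  @ProbabilityTheory.uniformOn (Content bos copy) ⊤ Set.univ

/-- The words of a sequence of non-special tokens. -/
def wordsOf {bos copy : α} {n : ℕ} (x : Fin n → Content bos copy) : List α :=
  List.ofFn fun i => (x i : α)

/-- The prompt `bos x_1 ⋯ x_n copy`. -/
def prompt {bos copy : α} {n : ℕ} (x : Fin n → Content bos copy) : List α :=
  bos :: (wordsOf x ++ [copy])

/-- `err_n`: the probability that the `n` words generated from the prompt `bos x_1 ⋯ x_n copy` are
not `x_1, …, x_n`, where `x_1, …, x_n` are independent and uniform on the non-special words. -/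
def copyError {D : ℕ} (bos copy : α) (F : Seq α → Seq (Fin D)) (Wdec : Matrix (Fin D) α ℝ)
    (n : ℕ) : ℝ :=
  letI : MeasurableSpace (Content bos copy) := ⊤
  (Measure.pi fun _ : Fin n => uniformContent bos copy).real
    {x | generate (nextWord F Wdec) (prompt x) n ≠ some (wordsOf x)}

/-- The size bound `C log^37(1/ε) log^42(V) log^8(N)`, where the logarithms of `1/ε` and of `V` are
replaced by `1` when they are smaller than `1`. -/
def sizeBound (C ε : ℝ) (V N : ℕ) : ℝ :=
  C * (max 1 (Real.log ε⁻¹)) ^ 37 * (max 1 (Real.log V)) ^ 42 * (Real.log N) ^ 8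

end SSM

end

/-!
The model below makes no error at all: exact real arithmetic with tiny weights leaves nothing to
approximate, so that `ε` plays no role, and the number `N` of words enters the weights only.

Count positions from `bos`, write `κ_m` for the code of the word at position `m` (special words have
code `0`), and suppose that `x_q` with `q = i + 1` has to be produced, where `i` words have already
been copied. The difficulty is that a window of `V + 1` tokens, at each of the two convolutions, can
be shorter than the text. What has to be isolated is a word whose position depends on the length of
the prompt, while a filter has only four parameters.

*Weighted sums.* The first convolution computes, at each token, the sums of the preceding codes
against the taper `cos (π j / (2 (V + 1)))` and against the same taper shifted by one. The taper
vanishes at the end of the window, so the two sums telescope between adjacent tokens (`tapered_eq`).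
Low-frequency sines measure the distance of a token from `bos` and from `copy` to within a rounding
error (`abs_lag_sub_le`), and a ReLU network multiplies the tapered sums by any weight that is a
product of factors depending on the binary digits of such a distance (`exists_isReLUNet_program`).
After summation in the second convolution this gives `∑ w m * κ_m` over the tokens of the window,
for every such weight `w`, up to two boundary terms (`readout_eq`).

*Isolating a word.* With the superdecreasing weights `w m = y ^ m`, `y` small, the first token of
the window dominates. If the prompt has length `n = V`, then this is the wanted word, or rather its
successors are negligible and the boundary term is supplied by the words copied so far
(`CopySignal.abs_full_sub_le`). If `n < V`, the window starts `g = V - n` tokens before the wanted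
one. Take `2 ^ b ≤ g < 2 ^ (b + 1)`, cut the positions into blocks of length `2 ^ b` and read the
blocks in the residue class modulo `4` of the block of the wanted word only. The words of that block
which precede the wanted one have already been copied; the copies are read off with the distance
from `copy`, with weights that make the earlier blocks negligible, and subtracted. The remaining
blocks of the class are too far before the wanted word to lie in the window or too far behind to
matter (`CopySignal.abs_block_sub_le`). In all cases there remains the emission of the current
token, which is recovered with weights increasing with the position
(`CopySignal.abs_latest_sub_le`). The second network knows `n` and `i`, selects the scale `b` and
the residue class, and brings the parts to a common weight. Its two outputs have a quotient close to
`κ_q`, but are themselves extremely small (`exists_retrieval`).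

*Decoding.* The order of scores that are linear in the two outputs does not depend on the common
size of the outputs: with the word `w` as the point `(κ_w, -κ_w ^ 2 / 2)` of a parabola, the scores
order the words by their distance from the quotient (`parabola_lt`).

All of this takes `O(log V)` coordinates and layers, and weights polynomial in `V`.
-/

noncomputable section

namespace SSM

section

/-! ### ReLU networks between arbitrary finite index types -/

variable {ι κ : Type} [Fintype ι] [Fintype κ]

/-- The map `f` is computed by a ReLU network of depth `L`, width at most `W` and weights bounded by
`B`, once the finite index types `ι` and `κ` are enumerated.  Sparsity is not recorded: it is bounded
by depth and width, see `FNN.nnz_le`. -/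
def IsReLUNet (L W : ℕ) (B : ℝ) (f : (ι → ℝ) → (κ → ℝ)) : Prop :=
  ∃ φ : FNN L (Fintype.card ι) (Fintype.card κ), φ.width ≤ W ∧ φ.BoundedBy B ∧
    ∀ x k, f x k = φ.eval (fun a => x ((Fintype.equivFin ι).symm a)) (Fintype.equivFin κ k)

lemma matNnz_add_vecNnz_le {m n W : ℕ} (A : Matrix (Fin n) (Fin m) ℝ) (b : Fin n → ℝ)
    (hm : m ≤ W) (hn : n ≤ W) : matNnz A + vecNnz b ≤ W * W + W := by
  have h1 : matNnz A ≤ n * m := by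
    unfold matNnz
    exact (Finite.card_subtype_le _).trans_eq (by simp)
  have h2 : vecNnz b ≤ n := by
    unfold vecNnz
    exact (Finite.card_subtype_le _).trans_eq (by simp)
  exact add_le_add (h1.trans (Nat.mul_le_mul hn hm)) (h2.trans hn)

lemma FNN.le_width : {L m n : ℕ} → (φ : FNN L m n) → n ≤ φ.width
  | _, _, _, .affine _ _ => le_max_right _ _
  | _, _, _, .comp _ _ _ => le_max_right _ _

lemma FNN.nnz_le {W : ℕ} : {L m n : ℕ} → (φ : FNN L m n) → φ.width ≤ W →
    φ.nnz ≤ L * (W * W + W)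
  | _, m, n, .affine A b, h => by
    have := matNnz_add_vecNnz_le A b ((le_max_left m n).trans h) ((le_max_right m n).trans h)
    simpa [FNN.nnz] using this
  | _, _, _, .comp (L := L) f A b, h => by
    have hf : f.width ≤ W := (le_max_left _ _).trans h
    have h1 := f.nnz_le hf
    have h2 := matNnz_add_vecNnz_le A b (f.le_width.trans hf) ((le_max_right _ _).trans h)
    have : (L + 1) * (W * W + W) = L * (W * W + W) + (W * W + W) := by ring
    simp only [FNN.nnz]
    omega

lemma IsReLUNet.affine {W : ℕ} {B : ℝ} (A : Matrix κ ι ℝ) (b : κ → ℝ)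
    (hι : Fintype.card ι ≤ W) (hκ : Fintype.card κ ≤ W)
    (hA : ∀ k i, |A k i| ≤ B) (hb : ∀ k, |b k| ≤ B) :
    IsReLUNet 1 W B (fun x k => ∑ i, A k i * x i + b k) := by
  refine ⟨.affine (fun k i => A ((Fintype.equivFin κ).symm k) ((Fintype.equivFin ι).symm i))
    (fun k => b ((Fintype.equivFin κ).symm k)), max_le hι hκ, ⟨fun _ _ => hA _ _, fun _ => hb _⟩, ?_⟩
  intro x k
  simp only [FNN.eval, Matrix.mulVec, dotProduct, Pi.add_apply, Equiv.symm_apply_apply]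
  rw [← Equiv.sum_comp (Fintype.equivFin ι)]
  simp

lemma IsReLUNet.comp {μ : Type} [Fintype μ] {L W : ℕ} {B : ℝ} {f : (μ → ℝ) → (ι → ℝ)}
    (hf : IsReLUNet L W B f) (A : Matrix κ ι ℝ) (b : κ → ℝ)
    (hκ : Fintype.card κ ≤ W) (hA : ∀ k i, |A k i| ≤ B) (hb : ∀ k, |b k| ≤ B) :
    IsReLUNet (L + 1) W B (fun x k => ∑ i, A k i * max (f x i) 0 + b k) := by
  obtain ⟨φ, hW, hB, hφ⟩ := hf
  refine ⟨.comp φ (fun k i => A ((Fintype.equivFin κ).symm k) ((Fintype.equivFin ι).symm i))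
    (fun k => b ((Fintype.equivFin κ).symm k)), max_le hW hκ,
    ⟨hB, fun _ _ => hA _ _, fun _ => hb _⟩, ?_⟩
  intro x k
  simp only [FNN.eval, Matrix.mulVec, dotProduct, Pi.add_apply, Equiv.symm_apply_apply]
  rw [← Equiv.sum_comp (Fintype.equivFin ι)]
  simp [hφ]

lemma IsReLUNet.mem_fnnClass {L W S : ℕ} {B : ℝ} {f : (ι → ℝ) → (κ → ℝ)}
    (hf : IsReLUNet L W B f) (hS : L * (W * W + W) ≤ S) :
    (fun x k => f (fun i => x (Fintype.equivFin ι i)) ((Fintype.equivFin κ).symm k)) ∈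
      fnnClass (Fintype.card ι) (Fintype.card κ) L W S B := by
  obtain ⟨φ, hW, hB, hφ⟩ := hf
  refine ⟨φ, hW, (φ.nnz_le hW).trans hS, hB, ?_⟩
  funext x k
  simp [hφ]

/-- A layer acting blockwise: block `c` of the output depends on block `c` of the input only. -/
lemma IsReLUNet.compBlock {μ C : Type} [Fintype μ] [Fintype C] [DecidableEq C] {r s L W : ℕ}
    {B : ℝ} {f : (μ → ℝ) → (C × Fin s → ℝ)} (hf : IsReLUNet L W B f)
    (a : C → Fin r → Fin s → ℝ) (b : C → Fin r → ℝ) (hB : 0 ≤ B)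
    (hW : Fintype.card C * r ≤ W) (ha : ∀ c k i, |a c k i| ≤ B) (hb : ∀ c k, |b c k| ≤ B) :
    IsReLUNet (L + 1) W B
      (fun x (k : C × Fin r) => ∑ i, a k.1 k.2 i * max (f x (k.1, i)) 0 + b k.1 k.2) := by
  have := hf.comp (κ := C × Fin r)
    (fun k i => if i.1 = k.1 then a k.1 k.2 i.2 else 0) (fun k => b k.1 k.2)
    (by simpa using hW) (fun k i => by split_ifs <;> simp [ha, hB]) (fun k => hb _ _)
  convert this using 3 with x k
  rw [Fintype.sum_prod_type, Finset.sum_eq_single k.1]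
  · simp
  · intro c _ hc
    simp [hc]
  · simp

end

section

/-! ### Multiplication by a weight that depends on the binary digits of a register -/

/-- One step of a digit program, acting on a pair of a natural number `n` (the register) and a real
number `v`: if `thr ≤ n`, subtract `sub` from `n` and multiply `v` by `on`; otherwise keep `n` and
multiply `v` by `off`. -/
structure DigitStep where
  /-- the threshold that the register is compared with -/
  thr : ℕ
  /-- the number subtracted from the register above the threshold -/
  sub : ℕ
  /-- the factor below the threshold -/
  off : ℝ
  /-- the factor above the threshold -/
  on : ℝ

/-- The side conditions under which a ReLU network with weights at most `B` performs the step. -/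
structure DigitStep.Admissible (B : ℝ) (s : DigitStep) : Prop where
  sub_le : s.sub ≤ s.thr
  thr_le : 2 * (s.thr : ℝ) + 2 ≤ B
  off_nonneg : 0 ≤ s.off
  off_le : s.off ≤ 1
  on_nonneg : 0 ≤ s.on
  on_le : s.on ≤ 1

variable {C : Type}

/-- The factor by which a program, run in parallel on the channels `C`, multiplies the real number
of channel `c` when the register of `c` starts at `n`. -/
def programWeight : List (C → DigitStep) → C → ℕ → ℝ
  | [], _, _ => 1
  | s :: P, c, n =>
    if (s c).thr ≤ n then (s c).on * programWeight P c (n - (s c).sub)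
    else (s c).off * programWeight P c n

/-- The block of four numbers through which a register `u` and a value `v` pass a ReLU layer
unharmed. -/
def signedPair (u v : ℝ) : Fin 4 → ℝ := ![u, -u, v, -v]

lemma max_sub_max_neg (x : ℝ) : max x 0 - max (-x) 0 = x := by
  rcases le_total 0 x with h | h
  · rw [max_eq_left h, max_eq_right (by linarith)]; ring
  · rw [max_eq_right h, max_eq_left (by linarith)]; ring

/-- The difference of two ReLUs is exactly `0` or `1` off a gap of length `1/2` below the
threshold. -/
lemma relu_threshold {u : ℝ} {n θ : ℕ} (h : |u - n| ≤ 1 / 4) :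
    max (2 * u + (-2 * θ + 3 / 2)) 0 - max (2 * u + (-2 * θ + 1 / 2)) 0 =
      if θ ≤ n then 1 else 0 := by
  obtain ⟨h1, h2⟩ := abs_le.1 h
  split_ifs with hθ
  · have : (θ : ℝ) ≤ n := by exact_mod_cast hθ
    rw [max_eq_left (by linarith), max_eq_left (by linarith)]
    ring
  · have : (n : ℝ) + 1 ≤ θ := by exact_mod_cast not_le.1 hθ
    rw [max_eq_right (by linarith), max_eq_right (by linarith)]
    ring

/-- Gating: a value `v` with `|v| ≤ M` passes if `t = 1` and is replaced by `0` if `t = 0`. -/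
lemma relu_gate {M v t : ℝ} (h : |v| ≤ M) (ht : t = 0 ∨ t = 1) :
    max (v + (M * t - M)) 0 - max (-v + (M * t - M)) 0 = t * v := by
  obtain ⟨h1, h2⟩ := abs_le.1 h
  rcases ht with rfl | rfl
  · rw [max_eq_right (by linarith), max_eq_right (by linarith)]
    ring
  · simp

variable {μ : Type} [Fintype μ] [Fintype C] [DecidableEq C]

/-- Three layers perform one step of a digit program in every channel. -/
lemma IsReLUNet.digitStep {L W : ℕ} {B M : ℝ} {f : (μ → ℝ) → (C × Fin 4 → ℝ)}
    (hf : IsReLUNet L W B f) (s : C → DigitStep) (hs : ∀ c, (s c).Admissible B)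
    (hM : 0 ≤ M) (hMB : M ≤ B) (hB : 2 ≤ B) (hW : Fintype.card C * 6 ≤ W) :
    ∃ f' : (μ → ℝ) → (C × Fin 4 → ℝ), IsReLUNet (L + 3) W B f' ∧
      ∀ x c (n : ℕ) (u v : ℝ), |u - n| ≤ 1 / 4 → |v| ≤ M →
        (fun i => f x (c, i)) = signedPair u v →
        (fun i => f' x (c, i)) =
          if (s c).thr ≤ n then signedPair (u - (s c).sub) ((s c).on * v)
          else signedPair u ((s c).off * v) := by
  have hthr : ∀ c, 2 * ((s c).thr : ℝ) + 2 ≤ B := fun c => (hs c).thr_le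
  have hthr0 : ∀ c, (0 : ℝ) ≤ (s c).thr := fun c => by positivity
  have hsub : ∀ c, ((s c).sub : ℝ) ≤ (s c).thr := fun c => by exact_mod_cast (hs c).sub_le
  have hsub0 : ∀ c, (0 : ℝ) ≤ (s c).sub := fun c => by positivity
  obtain ⟨f₁, h₁, k₁⟩ : ∃ f₁ : (μ → ℝ) → (C × Fin 6 → ℝ), IsReLUNet (L + 1) W B f₁ ∧
      ∀ x c (u v : ℝ), (fun i => f x (c, i)) = signedPair u v → (fun i => f₁ x (c, i)) =
        ![2 * u + (-2 * (s c).thr + 3 / 2), 2 * u + (-2 * (s c).thr + 1 / 2), u, -u, v, -v] := by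
    refine ⟨_, hf.compBlock (r := 6)
      (fun _ => ![![2, -2, 0, 0], ![2, -2, 0, 0], ![1, -1, 0, 0], ![-1, 1, 0, 0],
        ![0, 0, 1, -1], ![0, 0, -1, 1]])
      (fun c => ![-2 * (s c).thr + 3 / 2, -2 * (s c).thr + 1 / 2, 0, 0, 0, 0])
      (by linarith) hW ?_ ?_, ?_⟩
    · intro c k i
      fin_cases k <;> fin_cases i <;> simp <;> linarith
    · intro c k
      have := hthr c
      have := hthr0 c
      fin_cases k <;> simp [abs_le] <;> (try constructor) <;> linarith
    · intro x c u v hx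
      have e0 : f x (c, 0) = u := congrFun hx 0
      have e1 : f x (c, 1) = -u := congrFun hx 1
      have e2 : f x (c, 2) = v := congrFun hx 2
      have e3 : f x (c, 3) = -v := congrFun hx 3
      have hu' := max_sub_max_neg u
      have hv' := max_sub_max_neg v
      funext i
      fin_cases i <;> simp [Fin.sum_univ_succ, e0, e1, e2, e3] <;> linarith
  obtain ⟨f₂, h₂, k₂⟩ : ∃ f₂ : (μ → ℝ) → (C × Fin 6 → ℝ), IsReLUNet (L + 2) W B f₂ ∧
      ∀ x c (a b u v t : ℝ), (fun i => f₁ x (c, i)) = ![a, b, u, -u, v, -v] →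
        max a 0 - max b 0 = t → (fun i => f₂ x (c, i)) =
        ![v + (M * t - M), -v + (M * t - M), u - (s c).sub * t, -(u - (s c).sub * t), v, -v] := by
    refine ⟨_, h₁.compBlock (r := 6)
      (fun c => ![![M, -M, 0, 0, 1, -1], ![M, -M, 0, 0, -1, 1],
        ![-(s c).sub, (s c).sub, 1, -1, 0, 0], ![(s c).sub, -(s c).sub, -1, 1, 0, 0],
        ![0, 0, 0, 0, 1, -1], ![0, 0, 0, 0, -1, 1]])
      (fun c => ![-M, -M, 0, 0, 0, 0])
      (by linarith) hW ?_ ?_, ?_⟩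
    · intro c k i
      have := hthr c
      have := hsub c
      have := hsub0 c
      fin_cases k <;> fin_cases i <;> simp [abs_le] <;> (try constructor) <;> linarith
    · intro c k
      fin_cases k <;> simp [abs_le] <;> (try constructor) <;> linarith
    · intro x c a b u v t hx ht
      have e0 : f₁ x (c, 0) = a := congrFun hx 0
      have e1 : f₁ x (c, 1) = b := congrFun hx 1
      have e2 : f₁ x (c, 2) = u := congrFun hx 2
      have e3 : f₁ x (c, 3) = -u := congrFun hx 3
      have e4 : f₁ x (c, 4) = v := congrFun hx 4
      have e5 : f₁ x (c, 5) = -v := congrFun hx 5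
      have hu' := max_sub_max_neg u
      have hv' := max_sub_max_neg v
      obtain ha : max a 0 = t + max b 0 := by linarith
      funext i
      fin_cases i <;> simp [Fin.sum_univ_succ, e0, e1, e2, e3, e4, e5, ha] <;> linarith
  refine ⟨_, h₂.compBlock (r := 4)
    (fun c => ![![0, 0, 1, -1, 0, 0], ![0, 0, -1, 1, 0, 0],
      ![(s c).on - (s c).off, (s c).off - (s c).on, 0, 0, (s c).off, -(s c).off],
      ![(s c).off - (s c).on, (s c).on - (s c).off, 0, 0, -(s c).off, (s c).off]])
    (fun c _ => 0) (by linarith) (by omega) ?_ ?_, ?_⟩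
  · intro c k i
    have := (hs c).on_le
    have := (hs c).on_nonneg
    have := (hs c).off_le
    have := (hs c).off_nonneg
    fin_cases k <;> fin_cases i <;> simp [abs_le] <;> (try constructor) <;> linarith
  · intro c k
    simp
    linarith
  · intro x c n u v hu hv hx
    have ht := relu_threshold (θ := (s c).thr) hu
    set t : ℝ := if (s c).thr ≤ n then 1 else 0 with htdef
    have ht01 : t = 0 ∨ t = 1 := by
      rw [htdef]; split_ifs <;> simp
    have hx₂ := k₂ x c _ _ u v t (k₁ x c u v hx) ht
    have hres : (if (s c).thr ≤ n then signedPair (u - (s c).sub) ((s c).on * v)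
        else signedPair u ((s c).off * v)) =
        signedPair (u - (s c).sub * t) ((s c).off * v + ((s c).on - (s c).off) * (t * v)) := by
      rw [htdef]; split_ifs <;> congr 1 <;> ring
    rw [hres]
    have hg : max (v + (M * t - M)) 0 = t * v + max (-v + (M * t - M)) 0 := by
      have := relu_gate hv ht01
      linarith
    have hw := max_sub_max_neg (u - (s c).sub * t)
    have hv' : max v 0 = v + max (-v) 0 := by
      have := max_sub_max_neg v
      linarith
    have e0 : f₂ x (c, 0) = v + (M * t - M) := congrFun hx₂ 0
    have e1 : f₂ x (c, 1) = -v + (M * t - M) := congrFun hx₂ 1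
    have e2 : f₂ x (c, 2) = u - (s c).sub * t := congrFun hx₂ 2
    have e3 : f₂ x (c, 3) = -(u - (s c).sub * t) := congrFun hx₂ 3
    have e4 : f₂ x (c, 4) = v := congrFun hx₂ 4
    have e5 : f₂ x (c, 5) = -v := congrFun hx₂ 5
    funext i
    fin_cases i
    · simp [Fin.sum_univ_succ, e0, e1, e2, e3, e4, signedPair, -neg_sub]
      linarith
    · simp [Fin.sum_univ_succ, e0, e1, e2, e3, e4, signedPair, -neg_sub]
      linarith
    · simp [Fin.sum_univ_succ, e0, e1, e2, e3, e4, e5, signedPair, hg, hv']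
      ring
    · simp [Fin.sum_univ_succ, e0, e1, e2, e3, e4, e5, signedPair, hg, hv']
      ring

/-- Every program is performed by a ReLU network. -/
lemma IsReLUNet.program {W : ℕ} {B M : ℝ} (hM : 0 ≤ M) (hMB : M ≤ B) (hB : 2 ≤ B)
    (hW : Fintype.card C * 6 ≤ W) (P : List (C → DigitStep))
    (hP : ∀ s ∈ P, ∀ c, (s c).Admissible B) {L : ℕ} {f : (μ → ℝ) → (C × Fin 4 → ℝ)}
    (hf : IsReLUNet L W B f) :
    ∃ f' : (μ → ℝ) → (C × Fin 4 → ℝ), IsReLUNet (L + 3 * P.length) W B f' ∧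
      ∀ x c (n : ℕ) (u v : ℝ), |u - n| ≤ 1 / 4 → |v| ≤ M →
        (fun i => f x (c, i)) = signedPair u v →
        ∃ u', (fun i => f' x (c, i)) = signedPair u' (programWeight P c n * v) := by
  induction P generalizing L f with
  | nil => exact ⟨f, hf, fun x c n u v _ _ h => ⟨u, by simpa [programWeight] using h⟩⟩
  | cons s P ih =>
    have hs := hP s (by simp)
    obtain ⟨f₁, h₁, k₁⟩ := hf.digitStep s hs hM hMB hB hW
    obtain ⟨f₂, h₂, k₂⟩ := ih (fun s hs => hP s (by simp [hs])) h₁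
    refine ⟨f₂, ?_, ?_⟩
    · convert h₂ using 1
      simp
      ring
    · intro x c n u v hu hv hx
      have h := k₁ x c n u v hu hv hx
      have hle : ∀ a : ℝ, 0 ≤ a → a ≤ 1 → |a * v| ≤ M := by
        intro a h0 h1
        rw [abs_mul, abs_of_nonneg h0]
        nlinarith [abs_nonneg v]
      by_cases hθ : (s c).thr ≤ n
      · rw [if_pos hθ] at h
        have hn : (((n - (s c).sub : ℕ)) : ℝ) = n - (s c).sub :=
          Nat.cast_sub ((hs c).sub_le.trans hθ)
        obtain ⟨u', hu'⟩ := k₂ x c (n - (s c).sub) _ _ (by rw [hn]; convert hu using 2; ring)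
          (hle _ (hs c).on_nonneg (hs c).on_le) h
        refine ⟨u', ?_⟩
        rw [hu', programWeight, if_pos hθ]
        congr 1
        ring
      · rw [if_neg hθ] at h
        obtain ⟨u', hu'⟩ := k₂ x c n _ _ hu (hle _ (hs c).off_nonneg (hs c).off_le) h
        refine ⟨u', ?_⟩
        rw [hu', programWeight, if_neg hθ]
        congr 1
        ring

/-- Linear combinations of values multiplied by digit weights are ReLU networks: the register and
the value of each channel are affine functions of the input. -/
lemma exists_isReLUNet_program {κ : Type} [Fintype κ] {W : ℕ} {B M : ℝ} (hM : 0 ≤ M)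
    (hMB : M ≤ B) (hB : 2 ≤ B) (hW : Fintype.card C * 6 ≤ W) (hμ : Fintype.card μ ≤ W)
    (hκ : Fintype.card κ ≤ W) (P : List (C → DigitStep))
    (hP : ∀ s ∈ P, ∀ c, (s c).Admissible B)
    (U V : Matrix C μ ℝ) (u₀ v₀ : C → ℝ) (R : Matrix κ C ℝ)
    (hU : ∀ c i, |U c i| ≤ B) (hV : ∀ c i, |V c i| ≤ B) (hu₀ : ∀ c, |u₀ c| ≤ B)
    (hv₀ : ∀ c, |v₀ c| ≤ B) (hR : ∀ k c, |R k c| ≤ B) :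
    ∃ f : (μ → ℝ) → (κ → ℝ), IsReLUNet (3 * P.length + 2) W B f ∧
      ∀ x (n : C → ℕ), (∀ c, |∑ i, U c i * x i + u₀ c - n c| ≤ 1 / 4) →
        (∀ c, |∑ i, V c i * x i + v₀ c| ≤ M) →
        ∀ k, f x k = ∑ c, R k c * (programWeight P c (n c) * (∑ i, V c i * x i + v₀ c)) := by
  have h₀ : IsReLUNet 1 W B (fun (x : μ → ℝ) (k : C × Fin 4) =>
      ∑ i, ![U k.1 i, -U k.1 i, V k.1 i, -V k.1 i] k.2 * x i +
        ![u₀ k.1, -u₀ k.1, v₀ k.1, -v₀ k.1] k.2) := by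
    apply IsReLUNet.affine (κ := C × Fin 4)
      (fun k i => ![U k.1 i, -U k.1 i, V k.1 i, -V k.1 i] k.2)
      (fun k => ![u₀ k.1, -u₀ k.1, v₀ k.1, -v₀ k.1] k.2) hμ (by simp; omega)
    · rintro ⟨c, k⟩ i
      fin_cases k <;> simp [hU, hV]
    · rintro ⟨c, k⟩
      fin_cases k <;> simp [hu₀, hv₀]
  obtain ⟨f₁, h₁, k₁⟩ := h₀.program hM hMB hB hW P hP
  obtain ⟨f, hf, k⟩ : ∃ f : (μ → ℝ) → (κ → ℝ), IsReLUNet (1 + 3 * P.length + 1) W B f ∧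
      ∀ x k, f x k = ∑ p : C × Fin 4, ![0, 0, R k p.1, -R k p.1] p.2 * max (f₁ x p) 0 := by
    refine ⟨_, h₁.comp (κ := κ) (fun k p => ![0, 0, R k p.1, -R k p.1] p.2) (fun _ => 0) hκ ?_ ?_,
      fun x k => add_zero _⟩
    · rintro k ⟨c, i⟩
      fin_cases i <;> simp [hR] <;> linarith
    · intro k
      simp
      linarith
  refine ⟨f, by convert hf using 1; ring, ?_⟩
  intro x n hn hv j
  rw [k, Fintype.sum_prod_type]
  refine Finset.sum_congr rfl fun c _ => ?_
  obtain ⟨u', hu'⟩ := k₁ x c (n c) _ _ (hn c) (hv c) (by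
    funext i
    fin_cases i <;> simp [signedPair, Finset.sum_neg_distrib] <;> ring)
  have e2 := congrFun hu' 2
  have e3 := congrFun hu' 3
  simp only [signedPair] at e2 e3
  have := max_sub_max_neg (programWeight P c (n c) * (∑ i, V c i * x i + v₀ c))
  simp only [Fin.sum_univ_four, e2, e3]
  simp
  rw [← sub_eq_add_neg, ← mul_sub, this]

end

section

/-! ### Weights that are products over binary digits -/

/-- The product over `j < k` of the factors `d j bⱼ`, where `bⱼ` are the binary digits of `m`, for
`m < 2 ^ k`. -/
def digitWeight (d : ℕ → Bool → ℝ) : ℕ → ℕ → ℝ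
  | 0, _ => 1
  | k + 1, m =>
    if 2 ^ k ≤ m then d k true * digitWeight d k (m - 2 ^ k) else d k false * digitWeight d k m

lemma digitWeight_mul (d d' : ℕ → Bool → ℝ) (k m : ℕ) :
    digitWeight (fun j b => d j b * d' j b) k m = digitWeight d k m * digitWeight d' k m := by
  induction k generalizing m with
  | zero => simp [digitWeight]
  | succ k ih =>
    simp only [digitWeight]
    split_ifs <;> rw [ih] <;> ring

lemma digitWeight_one (k m : ℕ) : digitWeight (fun _ _ => 1) k m = 1 := by
  induction k generalizing m with
  | zero => simp [digitWeight]
  | succ k ih => simp [digitWeight, ih]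

/-- Digit factors of `m ↦ y ^ m`. -/
def powDigit (y : ℝ) (j : ℕ) (b : Bool) : ℝ := if b then y ^ 2 ^ j else 1

/-- Digit factors of `m ↦ y ^ (2 ^ k - 1 - m)`. -/
def coPowDigit (y : ℝ) (j : ℕ) (b : Bool) : ℝ := if b then 1 else y ^ 2 ^ j

/-- The index of the block of length `2 ^ b` that contains `m`, where `0, …, 2 ^ k - 1` is cut into
such blocks, counted from the end. -/
def blockIndex (k b m : ℕ) : ℕ := (2 ^ k - 1 - m) / 2 ^ b

/-- Digit factors of `m ↦ r ^ blockIndex k b m`. -/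
def blockPowDigit (r : ℝ) (b j : ℕ) (t : Bool) : ℝ := if t = true ∨ j < b then 1 else r ^ 2 ^ (j - b)

/-- Digit factors of the indicator function of `blockIndex k b m % 4 = c`. -/
def blockClassDigit (b c j : ℕ) (t : Bool) : ℝ :=
  if (j = b → (if t then 0 else 1) = c % 2) ∧ (j = b + 1 → (if t then 0 else 1) = c / 2)
  then 1 else 0

lemma digitWeight_powDigit (y : ℝ) (k m : ℕ) (hm : m < 2 ^ k) :
    digitWeight (powDigit y) k m = y ^ m := by
  induction k generalizing m with
  | zero =>
    obtain rfl : m = 0 := by simpa using hm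
    simp [digitWeight]
  | succ k ih =>
    rw [pow_succ] at hm
    rw [digitWeight]
    by_cases h : 2 ^ k ≤ m
    · rw [if_pos h, ih _ (by omega)]
      simp [powDigit, ← pow_add, h]
    · rw [if_neg h, ih _ (by omega)]
      simp [powDigit]

lemma co_digit_of_le {k m : ℕ} (h : 2 ^ k ≤ m) :
    2 ^ (k + 1) - 1 - m = 2 ^ k - 1 - (m - 2 ^ k) := by
  rw [pow_succ]
  omega

lemma co_digit_of_lt {k m : ℕ} (h : m < 2 ^ k) :
    2 ^ (k + 1) - 1 - m = 2 ^ k + (2 ^ k - 1 - m) := by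
  rw [pow_succ]
  omega

lemma digitWeight_coPowDigit (y : ℝ) (k m : ℕ) (hm : m < 2 ^ k) :
    digitWeight (coPowDigit y) k m = y ^ (2 ^ k - 1 - m) := by
  induction k generalizing m with
  | zero =>
    obtain rfl : m = 0 := by simpa using hm
    simp [digitWeight]
  | succ k ih =>
    rw [digitWeight]
    by_cases h : 2 ^ k ≤ m
    · rw [if_pos h, co_digit_of_le h, ih _ (by rw [pow_succ] at hm; omega)]
      simp [coPowDigit]
    · rw [if_neg h, co_digit_of_lt (not_le.1 h), ih _ (by omega), pow_add]
      simp [coPowDigit]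

lemma blockIndex_succ_of_le {k b m : ℕ} (h : 2 ^ k ≤ m) :
    blockIndex (k + 1) b m = blockIndex k b (m - 2 ^ k) := by
  rw [blockIndex, co_digit_of_le h, blockIndex]

lemma blockIndex_succ_of_lt {k b m : ℕ} (h : m < 2 ^ k) (hb : b ≤ k) :
    blockIndex (k + 1) b m = 2 ^ (k - b) + blockIndex k b m := by
  have : 2 ^ k = 2 ^ b * 2 ^ (k - b) := by rw [← pow_add]; congr 1; omega
  rw [blockIndex, co_digit_of_lt h, blockIndex]
  nth_rw 1 [this]
  rw [Nat.mul_add_div (by positivity)]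

lemma blockIndex_eq_zero {k b m : ℕ} (hb : k ≤ b) : blockIndex k b m = 0 := by
  have h1 : 2 ^ k ≤ 2 ^ b := Nat.pow_le_pow_right (by norm_num) hb
  have h2 : 0 < 2 ^ k := by positivity
  exact Nat.div_eq_of_lt (by omega)

lemma digitWeight_blockPowDigit (r : ℝ) (b k m : ℕ) (hm : m < 2 ^ k) :
    digitWeight (blockPowDigit r b) k m = r ^ blockIndex k b m := by
  induction k generalizing m with
  | zero => simp [digitWeight, blockIndex_eq_zero]
  | succ k ih =>
    simp only [digitWeight]
    rw [pow_succ] at hm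
    by_cases h : 2 ^ k ≤ m
    · rw [if_pos h, blockIndex_succ_of_le h, ih _ (by omega)]
      simp [blockPowDigit]
    · rw [if_neg h, ih _ (by omega)]
      by_cases hb : k < b
      · rw [blockIndex_eq_zero (by omega), blockIndex_eq_zero (by omega)]
        simp [blockPowDigit, hb]
      · rw [blockIndex_succ_of_lt (by omega) (by omega), pow_add]
        simp [blockPowDigit, hb]

lemma digitWeight_blockClassDigit_of_le (b c k m : ℕ) (hk : k ≤ b) :
    digitWeight (blockClassDigit b c) k m = 1 := by
  induction k generalizing m with
  | zero => simp [digitWeight]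
  | succ k ih =>
    have h1 : k ≠ b := by omega
    have h2 : k ≠ b + 1 := by omega
    simp [digitWeight, blockClassDigit, h1, h2, ih _ (by omega : k ≤ b)]

lemma digitWeight_blockClassDigit (b c k m : ℕ) (hc : c < 4) (hk : b + 2 ≤ k) (hm : m < 2 ^ k) :
    digitWeight (blockClassDigit b c) k m = if blockIndex k b m % 4 = c then 1 else 0 := by
  induction k, hk using Nat.le_induction generalizing m with
  | base =>
    have e : ∀ m, blockIndex b b m = 0 := fun m => blockIndex_eq_zero le_rfl
    have key : ∀ m < 2 ^ (b + 1), digitWeight (blockClassDigit b c) (b + 1) m =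
        if blockIndex (b + 1) b m = c % 2 then 1 else 0 := by
      intro m hm
      rw [digitWeight, digitWeight_blockClassDigit_of_le _ _ _ _ le_rfl,
        digitWeight_blockClassDigit_of_le _ _ _ _ le_rfl]
      by_cases h : 2 ^ b ≤ m
      · rw [if_pos h, blockIndex_succ_of_le h, e]
        simp [blockClassDigit]
      · rw [if_neg h, blockIndex_succ_of_lt (by omega) le_rfl, e]
        simp [blockClassDigit]
    have hlt : ∀ m, blockIndex (b + 1) b m < 2 := by
      intro m
      by_cases h : 2 ^ b ≤ m
      · rw [blockIndex_succ_of_le h, e]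
        norm_num
      · rw [blockIndex_succ_of_lt (by omega) le_rfl, e]
        simp
    have hm' : m < 2 ^ (b + 1) + 2 ^ (b + 1) := by rw [pow_succ] at hm; omega
    rw [digitWeight]
    by_cases h : 2 ^ (b + 1) ≤ m
    · rw [if_pos h, blockIndex_succ_of_le h, key _ (by omega)]
      have := hlt (m - 2 ^ (b + 1))
      generalize blockIndex (b + 1) b (m - 2 ^ (b + 1)) = z at *
      interval_cases c <;> interval_cases z <;> simp [blockClassDigit]
    · rw [if_neg h, blockIndex_succ_of_lt (by omega) (by omega), key _ (by omega)]
      have := hlt m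
      generalize blockIndex (b + 1) b m = z at *
      simp only [Nat.add_sub_cancel_left]
      interval_cases c <;> interval_cases z <;> simp [blockClassDigit]
  | succ k hk ih =>
    rw [pow_succ] at hm
    have h1 : k ≠ b := by omega
    have h2 : k ≠ b + 1 := by omega
    rw [digitWeight]
    by_cases h : 2 ^ k ≤ m
    · rw [if_pos h, blockIndex_succ_of_le h, ih _ (by omega)]
      simp [blockClassDigit, h1, h2]
    · rw [if_neg h, blockIndex_succ_of_lt (by omega) (by omega), ih _ (by omega)]
      obtain ⟨r, hr⟩ : ∃ r, k - b = r + 2 := ⟨k - b - 2, by omega⟩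
      have : 2 ^ (k - b) = 4 * 2 ^ r := by rw [hr, pow_add]; ring
      rw [this, Nat.mul_add_mod]
      simp [blockClassDigit, h1, h2]

/-! ### Digit programs -/

variable {C : Type}

/-- The program that multiplies by `digitWeight (d c) k n` in channel `c`. -/
def digitSteps (d : C → ℕ → Bool → ℝ) : ℕ → List (C → DigitStep)
  | 0 => []
  | k + 1 => (fun c => ⟨2 ^ k, 2 ^ k, d c k false, d c k true⟩) :: digitSteps d k

/-- The program that reduces the register modulo `2 ^ r`. -/
def reduceSteps (r : ℕ) : ℕ → List (C → DigitStep)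
  | 0 => []
  | k + 1 => (fun _ => ⟨2 ^ (r + k), 2 ^ (r + k), 1, 1⟩) :: reduceSteps r k

/-- A program of `k` steps without effect. -/
def idleSteps (k : ℕ) : List (C → DigitStep) := List.replicate k fun _ => ⟨0, 0, 1, 1⟩

lemma length_digitSteps (d : C → ℕ → Bool → ℝ) (k : ℕ) : (digitSteps d k).length = k := by
  induction k with
  | zero => rfl
  | succ k ih => simp [digitSteps, ih]

lemma length_reduceSteps (r k : ℕ) : (reduceSteps r k : List (C → DigitStep)).length = k := by
  induction k with
  | zero => rfl
  | succ k ih => simp [reduceSteps, ih]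

lemma programWeight_digitSteps (d : C → ℕ → Bool → ℝ) (k : ℕ) (c : C) (n : ℕ) :
    programWeight (digitSteps d k) c n = digitWeight (d c) k n := by
  induction k generalizing n with
  | zero => rfl
  | succ k ih => simp [digitSteps, programWeight, digitWeight, ih]

lemma programWeight_reduceSteps (r k : ℕ) (P : List (C → DigitStep)) (c : C) {q G : ℕ}
    (hq : q < 2 ^ r) (hG : G < 2 ^ k) :
    programWeight (reduceSteps r k ++ P) c (q + 2 ^ r * G) = programWeight P c q := by
  induction k generalizing G with
  | zero =>
    obtain rfl : G = 0 := by simpa using hG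
    simp [reduceSteps]
  | succ k ih =>
    simp only [reduceSteps, List.cons_append, programWeight, one_mul, pow_add]
    have hpos : 0 < 2 ^ r := by positivity
    by_cases h : 2 ^ k ≤ G
    · have h1 : 2 ^ r * 2 ^ k ≤ 2 ^ r * G := Nat.mul_le_mul_left _ h
      rw [if_pos (by omega), ← ih (G := G - 2 ^ k) (by rw [pow_succ] at hG; omega),
        Nat.mul_sub]
      congr 1
      omega
    · have h1 : 2 ^ r * (G + 1) ≤ 2 ^ r * 2 ^ k := Nat.mul_le_mul_left _ (by omega)
      rw [if_neg (by rw [mul_add] at h1; omega), ih (by omega)]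

lemma programWeight_idleSteps (k : ℕ) (P : List (C → DigitStep)) (c : C) (n : ℕ) :
    programWeight (idleSteps k ++ P) c n = programWeight P c n := by
  induction k with
  | zero => simp [idleSteps]
  | succ k ih =>
    rw [idleSteps] at ih
    simp [idleSteps, List.replicate_succ, programWeight, ih]

lemma admissible_of_mem_digitSteps {B : ℝ} {d : C → ℕ → Bool → ℝ} {k : ℕ}
    (hd : ∀ c j b, 0 ≤ d c j b ∧ d c j b ≤ 1) (hB : 2 * (2 : ℝ) ^ k + 2 ≤ B)
    {s : C → DigitStep} (hs : s ∈ digitSteps d k) (c : C) : (s c).Admissible B := by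
  induction k with
  | zero => simp [digitSteps] at hs
  | succ k ih =>
    have h1 : (2 : ℝ) ^ k ≤ 2 ^ (k + 1) := pow_le_pow_right₀ (by norm_num) (by omega)
    rcases List.mem_cons.1 hs with rfl | hs
    · exact ⟨le_rfl, by push_cast; linarith, (hd _ _ _).1, (hd _ _ _).2, (hd _ _ _).1, (hd _ _ _).2⟩
    · exact ih (by linarith) hs

lemma admissible_of_mem_reduceSteps {B : ℝ} {r k : ℕ} (hB : 2 * (2 : ℝ) ^ (r + k) + 2 ≤ B)
    {s : C → DigitStep} (hs : s ∈ reduceSteps r k) (c : C) : (s c).Admissible B := by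
  induction k with
  | zero => simp [reduceSteps] at hs
  | succ k ih =>
    have h1 : (2 : ℝ) ^ (r + k) ≤ 2 ^ (r + (k + 1)) := pow_le_pow_right₀ (by norm_num) (by omega)
    rcases List.mem_cons.1 hs with rfl | hs
    · exact ⟨le_rfl, by push_cast; linarith, by simp, by simp, by simp, by simp⟩
    · exact ih (by linarith) hs

lemma admissible_of_mem_idleSteps {B : ℝ} {k : ℕ} (hB : 2 ≤ B)
    {s : C → DigitStep} (hs : s ∈ idleSteps k) (c : C) : (s c).Admissible B := by
  rw [List.eq_of_mem_replicate hs]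
  exact ⟨le_rfl, by simpa using hB, by simp, by simp, by simp, by simp⟩

/-- Digit factors with values in `[0, 1]`. -/
def UnitDigits (d : ℕ → Bool → ℝ) : Prop := ∀ j b, 0 ≤ d j b ∧ d j b ≤ 1

lemma UnitDigits.mul {d d' : ℕ → Bool → ℝ} (h : UnitDigits d) (h' : UnitDigits d') :
    UnitDigits fun j b => d j b * d' j b := fun j b =>
  ⟨mul_nonneg (h j b).1 (h' j b).1, mul_le_one₀ (h j b).2 (h' j b).1 (h' j b).2⟩

lemma unitDigits_one : UnitDigits fun _ _ => 1 := fun _ _ => ⟨zero_le_one, le_rfl⟩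

lemma unitDigits_powDigit {y : ℝ} (h0 : 0 ≤ y) (h1 : y ≤ 1) : UnitDigits (powDigit y) := by
  intro j b
  unfold powDigit
  split_ifs
  exacts [⟨pow_nonneg h0 _, pow_le_one₀ h0 h1⟩, ⟨zero_le_one, le_rfl⟩]

lemma unitDigits_coPowDigit {y : ℝ} (h0 : 0 ≤ y) (h1 : y ≤ 1) : UnitDigits (coPowDigit y) := by
  intro j b
  unfold coPowDigit
  split_ifs
  exacts [⟨zero_le_one, le_rfl⟩, ⟨pow_nonneg h0 _, pow_le_one₀ h0 h1⟩]

lemma unitDigits_blockPowDigit {r : ℝ} (b : ℕ) (h0 : 0 ≤ r) (h1 : r ≤ 1) :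
    UnitDigits (blockPowDigit r b) := by
  intro j t
  unfold blockPowDigit
  split_ifs
  exacts [⟨zero_le_one, le_rfl⟩, ⟨pow_nonneg h0 _, pow_le_one₀ h0 h1⟩]

lemma unitDigits_blockClassDigit (b c : ℕ) : UnitDigits (blockClassDigit b c) := by
  intro j t
  unfold blockClassDigit
  split_ifs <;> norm_num

end

section

/-! ### Windowed sums of a signal and their telescoping -/

/-- The taper `cos (π j / (2 (V + 1)))`, equal to `1` at `0` and to `0` at `V + 1`. -/
def taper (V j : ℕ) : ℝ := Real.cos (2 * Real.pi * j * (1 / 4) / (V + 1))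

lemma taper_zero (V : ℕ) : taper V 0 = 1 := by simp [taper]

lemma taper_end (V : ℕ) : taper V (V + 1) = 0 := by
  have : (2 * Real.pi * ((V + 1 : ℕ) : ℝ) * (1 / 4) / (V + 1)) = Real.pi / 2 := by
    have : (V : ℝ) + 1 ≠ 0 := by positivity
    push_cast
    field_simp
    norm_num
  rw [taper, this, Real.cos_pi_div_two]

lemma abs_taper_le (V j : ℕ) : |taper V j| ≤ 1 := Real.abs_cos_le_one _

/-- The tapered sum of the last `V + 1` values of the signal `x`. -/
def tapered (V : ℕ) (x : ℕ → ℝ) (t : ℕ) : ℝ := ∑ j ∈ Finset.range (V + 1), taper V j * x (t + j)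

/-- The tapered sum of the last `V + 1` values of the signal `x`, as seen one position later. -/
def taperedSucc (V : ℕ) (x : ℕ → ℝ) (t : ℕ) : ℝ :=
  ∑ j ∈ Finset.range (V + 1), taper V (j + 1) * x (t + j)

/-- Since the taper vanishes where the window ends, the tapered sums of adjacent windows differ by
the current value only. -/
lemma tapered_eq (V : ℕ) (x : ℕ → ℝ) (t : ℕ) :
    tapered V x t = x t + taperedSucc V x (t + 1) := by
  rw [tapered, taperedSucc, Finset.sum_range_succ', Finset.sum_range_succ, taper_end, taper_zero]
  simp only [add_zero, one_mul, zero_mul]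
  rw [add_comm]
  congr 1
  refine Finset.sum_congr rfl fun j _ => ?_
  rw [add_assoc t 1 j, add_comm 1 j]

lemma abs_tapered_le {V : ℕ} {x : ℕ → ℝ} (hx : ∀ t, |x t| ≤ 1) (t : ℕ) :
    |tapered V x t| ≤ V + 1 := by
  refine (Finset.abs_sum_le_sum_abs _ _).trans ?_
  refine (Finset.sum_le_card_nsmul _ _ 1 fun j _ => ?_).trans (by simp)
  rw [abs_mul]
  exact mul_le_one₀ (abs_taper_le _ _) (abs_nonneg _) (hx _)

lemma abs_taperedSucc_le {V : ℕ} {x : ℕ → ℝ} (hx : ∀ t, |x t| ≤ 1) (t : ℕ) :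
    |taperedSucc V x t| ≤ V + 1 := by
  refine (Finset.abs_sum_le_sum_abs _ _).trans ?_
  refine (Finset.sum_le_card_nsmul _ _ 1 fun j _ => ?_).trans (by simp)
  rw [abs_mul]
  exact mul_le_one₀ (abs_taper_le _ _) (abs_nonneg _) (hx _)

/-- The distance from `t` back to the marked position `p`, if `p` lies in the window of `t`, and `0`
otherwise. -/
def markDist (V p t : ℕ) : ℕ := if t ≤ p ∧ p ≤ t + V then p - t else 0

/-- The distance from `t` back to the marked position `p` plus one, if `p` lies in the window of
`t`, and `0` otherwise. -/
def markDistSucc (V p t : ℕ) : ℕ := if t ≤ p ∧ p ≤ t + V then p - t + 1 else 0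

/-- The sum over a window of what the tokens emit, if the weight `w` depends on the distance from the
marked position. -/
def readout (V : ℕ) (w : ℕ → ℝ) (p : ℕ) (x : ℕ → ℝ) : ℝ :=
  ∑ t ∈ Finset.range (V + 1),
    (w (markDist V p t) * tapered V x t - w (markDistSucc V p t) * taperedSucc V x t)

/-- The tapered sums telescope: up to the two ends of the window, `readout` is the sum of the
signal, weighted by the distance from the mark. -/
lemma readout_eq {V : ℕ} {w : ℕ → ℝ} (hw : w 0 = 0) {p : ℕ} (hp : p ≤ 2 * V) (x : ℕ → ℝ) :
    readout V w p x = ∑ t ∈ Finset.range (V + 1), w (markDist V p t) * x t +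
      w (markDist V p V) * taperedSucc V x (V + 1) -
      w (min p V + 1) * taperedSucc V x (p - V) := by
  have key : ∀ t, w (markDist V p t) - w (markDistSucc V p (t + 1)) =
      if t + 1 + V = p then -w (V + 1) else 0 := by
    intro t
    unfold markDist markDistSucc
    split_ifs with h1 h2 h3 h4 h5 <;>
      first
      | omega
      | (rw [show p - t = p - (t + 1) + 1 by omega, sub_self])
      | (rw [show p - (t + 1) + 1 = V + 1 by omega, hw, zero_sub])
      | (rw [show p - t = 0 by omega, sub_self])
      | simp [hw]
  have h1 : readout V w p x = ∑ t ∈ Finset.range (V + 1), w (markDist V p t) * x t +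
      (∑ t ∈ Finset.range (V + 1), w (markDist V p t) * taperedSucc V x (t + 1) -
        ∑ t ∈ Finset.range (V + 1), w (markDistSucc V p t) * taperedSucc V x t) := by
    rw [readout, ← Finset.sum_sub_distrib, ← Finset.sum_add_distrib]
    refine Finset.sum_congr rfl fun t _ => ?_
    rw [tapered_eq]
    ring
  have h2 : ∑ t ∈ Finset.range V, w (markDist V p t) * taperedSucc V x (t + 1) -
      ∑ t ∈ Finset.range V, w (markDistSucc V p (t + 1)) * taperedSucc V x (t + 1) =
      if V < p then -w (V + 1) * taperedSucc V x (p - V) else 0 := by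
    rw [← Finset.sum_sub_distrib]
    simp_rw [← sub_mul, key]
    split_ifs with h
    · rw [Finset.sum_eq_single (p - V - 1)]
      · rw [if_pos (by omega), show p - V - 1 + 1 = p - V by omega]
      · intro t _ ht
        rw [if_neg (by omega), zero_mul]
      · intro ht
        exact absurd (Finset.mem_range.2 (by omega)) ht
    · refine Finset.sum_eq_zero fun t _ => ?_
      rw [if_neg (by omega), zero_mul]
  have h3 : w (markDistSucc V p 0) = if p ≤ V then w (p + 1) else 0 := by
    unfold markDistSucc
    split_ifs with h4 h5 <;> first | omega | simp
  rw [h1, Finset.sum_range_succ (fun t => w (markDist V p t) * taperedSucc V x (t + 1)),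
    Finset.sum_range_succ' (fun t => w (markDistSucc V p t) * taperedSucc V x t), h3]
  by_cases h : p ≤ V
  · rw [if_neg (by omega)] at h2
    rw [if_pos h, min_eq_left h, Nat.sub_eq_zero_of_le h]
    linarith
  · rw [if_pos (by omega)] at h2
    rw [if_neg h, min_eq_right (by omega)]
    linarith

lemma sum_markDist (V p : ℕ) (f : ℕ → ℝ) :
    ∑ t ∈ Finset.range (V + 1), (if t ≤ p ∧ p ≤ t + V then f (p - t) else 0) =
      ∑ m ∈ Finset.range (V + 1), (if m ≤ p ∧ p ≤ m + V then f m else 0) := by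
  rw [← Finset.sum_filter, ← Finset.sum_filter]
  refine Finset.sum_nbij' (fun t => p - t) (fun t => p - t) ?_ ?_ ?_ ?_ ?_ <;>
    simp only [Finset.mem_filter, Finset.mem_range] <;> intros <;> first | omega | trivial

/-! ### Retrieval of one token of the prompt -/

/-- The numerical signal of `bos x₁ ⋯ xₙ copy x₁ ⋯ xᵢ`: the code of the word at position `m`,
counted from the beginning, is `D m`; the code of `bos` is `0`, and that of `copy` is arbitrary. -/
structure CopySignal (V n i : ℕ) (D : ℕ → ℝ) : Prop where
  le : n ≤ V
  lt : i < n
  zero : D 0 = 0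
  rep : ∀ m, 1 ≤ m → m ≤ i → D (n + 1 + m) = D m
  bound : ∀ m, |D m| ≤ 1

/-- The signal `D 0, …, D p` read backwards from position `p`, continued by `0`. -/
def backward (D : ℕ → ℝ) (p t : ℕ) : ℝ := if t ≤ p then D (p - t) else 0

lemma abs_backward_le {D : ℕ → ℝ} (hD : ∀ m, |D m| ≤ 1) (p t : ℕ) : |backward D p t| ≤ 1 := by
  unfold backward
  split_ifs
  exacts [hD _, by simp]

/-- A weight that is switched off at distance `0`. -/
def offAtZero (w : ℕ → ℝ) (m : ℕ) : ℝ := if m = 0 then 0 else w m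

variable {V n i : ℕ} {D : ℕ → ℝ}

lemma sum_markDist_mul_backward (V p : ℕ) (D w : ℕ → ℝ) :
    ∑ t ∈ Finset.range (V + 1),
      offAtZero w (markDist V p t) * backward D p t =
    ∑ m ∈ Finset.range (V + 1),
      (if m ≤ p ∧ p ≤ m + V then offAtZero w m * D m else 0) := by
  rw [← sum_markDist V p fun m => offAtZero w m * D m]
  refine Finset.sum_congr rfl fun t _ => ?_
  unfold markDist backward
  split_ifs <;> first | omega | simp [offAtZero]

lemma CopySignal.sum_copy (h : CopySignal V n i D) (w : ℕ → ℝ) :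
    ∑ t ∈ Finset.range (V + 1), offAtZero w (markDist V i t) * backward D (n + 1 + i) t =
    ∑ m ∈ Finset.range (V + 1), (if m ≤ i then offAtZero w m * D m else 0) := by
  have hV := h.le
  have hi := h.lt
  have := sum_markDist V i fun m => offAtZero w m * D m
  have e : ∀ m, (m ≤ i ∧ i ≤ m + V) = (m ≤ i) := fun m => by
    simp only [eq_iff_iff, and_iff_left_iff_imp]; omega
  simp only [e] at this
  rw [← this]
  refine Finset.sum_congr rfl fun t _ => ?_
  unfold markDist
  by_cases ht : t < i
  · have : backward D (n + 1 + i) t = D (i - t) := by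
      rw [backward, if_pos (by omega), ← h.rep (i - t) (by omega) (by omega)]
      congr 1
      omega
    rw [this, if_pos ⟨by omega, by omega⟩, if_pos (by omega)]
  · have e1 : i - t = 0 := by omega
    simp [e1, offAtZero]

lemma CopySignal.readout_bos (h : CopySignal V n i D) (w : ℕ → ℝ) :
    readout V (offAtZero w) (n + 1 + i) (backward D (n + 1 + i)) =
      ∑ m ∈ Finset.range (V + 1),
        (if m ≤ n + 1 + i ∧ n + 1 + i ≤ m + V then offAtZero w m * D m else 0) +
      offAtZero w (n + 1 + i - V) * taperedSucc V (backward D (n + 1 + i)) (V + 1) -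
      w (min (n + 1 + i) V + 1) * taperedSucc V (backward D (n + 1 + i)) (n + 1 + i - V) := by
  have h1 := h.le
  have h2 := h.lt
  rw [readout_eq (by simp [offAtZero]) (by omega), sum_markDist_mul_backward]
  congr 2
  congr 1
  unfold markDist
  split_ifs with h3
  · rfl
  · rw [show n + 1 + i - V = 0 by omega]

lemma CopySignal.readout_copy (h : CopySignal V n i D) (w : ℕ → ℝ) :
    readout V (offAtZero w) i (backward D (n + 1 + i)) =
      ∑ m ∈ Finset.range (V + 1), (if m ≤ i then offAtZero w m * D m else 0) -
      w (i + 1) * taperedSucc V (backward D (n + 1 + i)) 0 := by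
  have h1 := h.le
  have h2 := h.lt
  have e : markDist V i V = 0 := by
    unfold markDist
    rw [if_neg (by omega)]
  rw [readout_eq (by simp [offAtZero]) (by omega), h.sum_copy, e, min_eq_left (by omega),
    Nat.sub_eq_zero_of_le (by omega)]
  simp [offAtZero]

/-- The emissions whose weight increases with the position are dominated by the latest one. -/
lemma CopySignal.abs_latest_sub_le (h : CopySignal V n i D) {y : ℝ} (hy0 : 0 < y) (hy1 : y ≤ 1)
    {H : ℕ} (hH : V + 1 ≤ H) :
    |∑ t ∈ Finset.range (V + 1), offAtZero (fun m => y ^ (H - 1 - m)) (markDistSucc V i t) *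
        taperedSucc V (backward D (n + 1 + i)) t -
      y ^ (H - 1 - (i + 1)) * taperedSucc V (backward D (n + 1 + i)) 0| ≤
    y ^ (H - 1 - (i + 1)) * (y * (V * (V + 1))) := by
  have h1 := h.le
  have h2 := h.lt
  have hb := abs_backward_le h.bound (n + 1 + i)
  rw [Finset.sum_range_succ']
  have e0 : markDistSucc V i 0 = i + 1 := by
    unfold markDistSucc
    rw [if_pos (by omega)]
    rfl
  rw [e0]
  have e1 : offAtZero (fun m => y ^ (H - 1 - m)) (i + 1) = y ^ (H - 1 - (i + 1)) := by
    simp [offAtZero]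
  rw [e1, add_sub_cancel_right]
  refine (Finset.abs_sum_le_sum_abs _ _).trans ?_
  have hle : ∀ t ∈ Finset.range V,
      |offAtZero (fun m => y ^ (H - 1 - m)) (markDistSucc V i (t + 1)) *
        taperedSucc V (backward D (n + 1 + i)) (t + 1)| ≤
      y ^ (H - 1 - (i + 1)) * (y * (V + 1)) := by
    intro t _
    rw [abs_mul, ← mul_assoc]
    refine mul_le_mul ?_ (abs_taperedSucc_le hb _) (abs_nonneg _) (by positivity)
    rw [← pow_succ]
    unfold offAtZero
    split_ifs with h3
    · simp only [abs_zero]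
      positivity
    · rw [abs_of_nonneg (by positivity)]
      refine pow_le_pow_of_le_one hy0.le hy1 ?_
      unfold markDistSucc at h3 ⊢
      split_ifs at h3 ⊢ with h4
      · omega
      · simp at h3
  refine (Finset.sum_le_card_nsmul _ _ _ hle).trans (le_of_eq ?_)
  simp
  ring

/-- If the window does not reach the token preceding the wanted one, then that token is the leading
one of the window, up to a tapered sum of its predecessors, which the later copies supply. -/
lemma CopySignal.abs_full_sub_le (h : CopySignal V V i D) {y : ℝ} (hy0 : 0 < y) (hy1 : y ≤ 1) :
    |readout V (offAtZero (fun m => y ^ m)) (V + 1 + i) (backward D (V + 1 + i)) -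
      y ^ (i + 1) * (∑ t ∈ Finset.range (V + 1), taper V (t + 1) *
          (offAtZero (fun _ => 1) (markDist V i t) * tapered V (backward D (V + 1 + i)) t) -
        ∑ t ∈ Finset.range (V + 1), taper V t *
          (offAtZero (fun _ => 1) (markDistSucc V i t) *
            taperedSucc V (backward D (V + 1 + i)) t)) -
      y ^ (i + 1) * taperedSucc V (backward D (V + 1 + i)) 0 - y ^ (i + 1) * D (i + 1)| ≤
    y ^ (i + 1) * (y * (2 * (V + 1))) := by
  have hi := h.lt
  have hb := abs_backward_le h.bound (V + 1 + i)
  set x := backward D (V + 1 + i) with hx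
  -- the copies know the tapered sum of the predecessors up to what the current token emits
  have hprev : ∑ t ∈ Finset.range (V + 1), taper V (t + 1) *
          (offAtZero (fun _ => 1) (markDist V i t) * tapered V x t) -
        ∑ t ∈ Finset.range (V + 1), taper V t *
          (offAtZero (fun _ => 1) (markDistSucc V i t) * taperedSucc V x t) =
      taperedSucc V x (V + 1) - taperedSucc V x 0 := by
    rw [Finset.sum_range_succ' (fun t => taper V t *
      (offAtZero (fun _ => 1) (markDistSucc V i t) * taperedSucc V x t))]
    have e0 : offAtZero (fun _ => 1) (markDistSucc V i 0) = 1 := by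
      unfold markDistSucc
      rw [if_pos (by omega)]
      simp [offAtZero]
    rw [e0, taper_zero, one_mul, one_mul, ← sub_sub, sub_left_inj,
      Finset.sum_range_succ (fun t => taper V (t + 1) *
      (offAtZero (fun _ => 1) (markDist V i t) * tapered V x t))]
    rw [taper_end, zero_mul, add_zero, ← Finset.sum_sub_distrib, taperedSucc,
      Finset.sum_range_succ, taper_end, zero_mul, add_zero]
    refine Finset.sum_congr rfl fun t _ => ?_
    by_cases ht : t < i
    · have e1 : offAtZero (fun _ => 1) (markDist V i t) = 1 := by
        unfold markDist
        rw [if_pos (by omega)]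
        simp only [offAtZero]
        rw [if_neg (by omega)]
      have e2 : offAtZero (fun _ => 1) (markDistSucc V i (t + 1)) = 1 := by
        unfold markDistSucc
        rw [if_pos (by omega)]
        simp [offAtZero]
      have e3 : x (V + 1 + t) = x t := by
        rw [hx, backward, backward, if_pos (by omega), if_pos (by omega),
          show V + 1 + i - t = V + 1 + (i - t) by omega, h.rep _ (by omega) (by omega)]
        congr 1
        omega
      rw [e1, e2, e3, tapered_eq]
      ring
    · have e1 : offAtZero (fun _ => 1) (markDist V i t) = 0 := by
        unfold markDist
        rw [show i - t = 0 by omega]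
        simp [offAtZero]
      have e2 : offAtZero (fun _ => 1) (markDistSucc V i (t + 1)) = 0 := by
        unfold markDistSucc
        rw [if_neg (by omega)]
        simp [offAtZero]
      have e3 : x (V + 1 + t) = 0 := by
        rw [hx, backward]
        split_ifs with h5
        · rw [show V + 1 + i - (V + 1 + t) = 0 by omega, h.zero]
        · rfl
      rw [e1, e2, e3]
      ring
  rw [hprev, h.readout_bos, ← hx, show V + 1 + i - V = i + 1 by omega,
    show min (V + 1 + i) V = V by omega]
  have hq : offAtZero (fun m => y ^ m) (i + 1) = y ^ (i + 1) := by simp [offAtZero]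
  have hsum : |∑ m ∈ Finset.range (V + 1),
      (if m ≤ V + 1 + i ∧ V + 1 + i ≤ m + V then offAtZero (fun m => y ^ m) m * D m else 0) -
      y ^ (i + 1) * D (i + 1)| ≤ y ^ (i + 1) * (y * (V + 1)) := by
    have e : y ^ (i + 1) * D (i + 1) = ∑ m ∈ Finset.range (V + 1),
        if m = i + 1 then y ^ (i + 1) * D m else 0 := by
      rw [Finset.sum_ite_eq', if_pos (Finset.mem_range.2 (by omega))]
    rw [e, ← Finset.sum_sub_distrib]
    refine (Finset.abs_sum_le_sum_abs _ _).trans ?_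
    refine (Finset.sum_le_card_nsmul _ _ (y ^ (i + 1) * y) fun m _ => ?_).trans
      (le_of_eq (by simp; ring))
    by_cases hm : m ≤ i + 1
    · rcases hm.lt_or_eq with hm | rfl
      · rw [if_neg (by omega), if_neg (by omega)]
        simp only [sub_zero, abs_zero]
        positivity
      · rw [if_pos (by omega), if_pos rfl, hq, sub_self, abs_zero]
        positivity
    · rw [if_neg (by omega : ¬ m = i + 1), sub_zero]
      split_ifs
      · rw [offAtZero, if_neg (by omega), abs_mul, abs_of_nonneg (by positivity : 0 ≤ y ^ m),
          ← pow_succ]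
        refine (mul_le_mul_of_nonneg_left (h.bound m) (by positivity)).trans ?_
        rw [mul_one]
        exact pow_le_pow_of_le_one hy0.le hy1 (by omega)
      · simp only [abs_zero]
        positivity
  have hend : |y ^ (V + 1) * taperedSucc V x (i + 1)| ≤ y ^ (i + 1) * (y * (V + 1)) := by
    rw [abs_mul, abs_of_nonneg (by positivity), ← mul_assoc, ← pow_succ]
    exact mul_le_mul (pow_le_pow_of_le_one hy0.le hy1 (by omega)) (abs_taperedSucc_le hb _)
      (abs_nonneg _) (by positivity)
  rw [hq]
  rw [abs_le] at hsum hend ⊢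
  constructor <;> linarith [hsum.1, hsum.2, hend.1, hend.2]

lemma blockIndex_mono {k b m q : ℕ} (h : m ≤ q) : blockIndex k b q ≤ blockIndex k b m :=
  Nat.div_le_div_right (by omega)

lemma blockIndex_le_add {k b m q c : ℕ} (h : q ≤ m + c * 2 ^ b) :
    blockIndex k b m ≤ blockIndex k b q + c := by
  unfold blockIndex
  rw [← Nat.add_mul_div_right _ _ (by positivity)]
  exact Nat.div_le_div_right (by omega)

lemma add_le_blockIndex {k b m q : ℕ} (hq : q < 2 ^ k) (h : m + 2 ^ b ≤ q) :
    blockIndex k b q + 1 ≤ blockIndex k b m := by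
  unfold blockIndex
  rw [← Nat.add_div_right _ (by positivity)]
  exact Nat.div_le_div_right (by omega)

/-- If the window ends `g` tokens before the wanted one with `2 ^ b ≤ g < 2 ^ (b + 1)`, then the
tokens of the same block of length `2 ^ b` that precede the wanted one are cancelled by their later
copies, and the blocks before it are either switched off or negligible. -/
lemma CopySignal.abs_block_sub_le (h : CopySignal V n i D) {y : ℝ} (hy0 : 0 < y) (hy1 : y ≤ 1)
    {k b : ℕ} (hk : V + 2 ≤ 2 ^ k) (hb0 : 2 ^ b ≤ V - n) (hb1 : V - n < 2 ^ (b + 1)) :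
    |(y ^ 2 ^ k) ^ blockIndex (k + 1) b (i + 1) *
        readout V (offAtZero (fun m => y ^ m *
          if blockIndex (k + 1) b m % 4 = blockIndex (k + 1) b (i + 1) % 4 then 1 else 0))
          (n + 1 + i) (backward D (n + 1 + i)) -
      readout V (offAtZero (fun m => y ^ m * (y ^ 2 ^ k) ^ blockIndex (k + 1) b m)) i
        (backward D (n + 1 + i)) -
      y ^ (i + 1) * (y ^ 2 ^ k) ^ blockIndex (k + 1) b (i + 1) *
        taperedSucc V (backward D (n + 1 + i)) 0 -
      y ^ (i + 1) * (y ^ 2 ^ k) ^ blockIndex (k + 1) b (i + 1) * D (i + 1)| ≤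
    y ^ (i + 1) * (y ^ 2 ^ k) ^ blockIndex (k + 1) b (i + 1) * (y * (2 * (V + 1))) := by
  have hn := h.le
  have hi := h.lt
  have hb := abs_backward_le h.bound (n + 1 + i)
  set x := backward D (n + 1 + i) with hx
  have hr0 : 0 < y ^ 2 ^ k := by positivity
  have hr1 : y ^ 2 ^ k ≤ 1 := pow_le_one₀ hy0.le hy1
  have hry : y ^ 2 ^ k ≤ y ^ (i + 1 + 1) := pow_le_pow_of_le_one hy0.le hy1 (by omega)
  have hqk : i + 1 < 2 ^ (k + 1) := by rw [pow_succ]; omega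
  rw [pow_succ] at hb1
  generalize y ^ 2 ^ k = r at *
  set κ := blockIndex (k + 1) b with hκ
  set R := r ^ κ (i + 1) with hR
  have hR0 : 0 < R := by positivity
  -- the start of the window lies in a block that is switched off
  have hstart : offAtZero (fun m => y ^ m *
      if κ m % 4 = κ (i + 1) % 4 then 1 else 0) (n + 1 + i - V) = 0 := by
    by_cases h1 : n + 1 + i - V = 0
    · simp [offAtZero, h1]
    · have h3 := add_le_blockIndex (b := b) (m := n + 1 + i - V) hqk (by omega)
      have h4 := blockIndex_le_add (k := k + 1) (b := b) (m := n + 1 + i - V) (q := i + 1) (c := 2)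
        (by omega)
      rw [← hκ] at h3 h4
      rw [offAtZero, if_neg h1, if_neg (by omega), mul_zero]
  rw [h.readout_bos, h.readout_copy, ← hx, hstart, zero_mul, add_zero]
  have hsum : |R * ∑ m ∈ Finset.range (V + 1),
        (if m ≤ n + 1 + i ∧ n + 1 + i ≤ m + V then offAtZero (fun m => y ^ m *
          if κ m % 4 = κ (i + 1) % 4 then 1 else 0) m * D m else 0) -
      ∑ m ∈ Finset.range (V + 1),
        (if m ≤ i then offAtZero (fun m => y ^ m * r ^ κ m) m * D m else 0) -
      y ^ (i + 1) * R * D (i + 1)| ≤ y ^ (i + 1) * R * (y * (V + 1)) := by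
    have e : y ^ (i + 1) * R * D (i + 1) = ∑ m ∈ Finset.range (V + 1),
        if m = i + 1 then y ^ (i + 1) * R * D m else 0 := by
      rw [Finset.sum_ite_eq', if_pos (Finset.mem_range.2 (by omega))]
    rw [e, Finset.mul_sum, ← Finset.sum_sub_distrib, ← Finset.sum_sub_distrib]
    refine (Finset.abs_sum_le_sum_abs _ _).trans ?_
    refine (Finset.sum_le_card_nsmul _ _ (y ^ (i + 1) * R * y) fun m hm => ?_).trans
      (le_of_eq (by simp; ring))
    have hmV := Finset.mem_range.1 hm
    have hpos : 0 ≤ y ^ (i + 1) * R * y := by positivity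
    rcases Nat.eq_zero_or_pos m with rfl | hm0
    · simpa [offAtZero] using hpos
    have hoff : ∀ w : ℕ → ℝ, offAtZero w m = w m := fun w => by
      rw [offAtZero, if_neg (by omega)]
    rw [hoff, hoff]
    rcases lt_trichotomy m (i + 1) with hlt | rfl | hgt
    · rw [if_pos (by omega : m ≤ i), if_neg (by omega : ¬ m = i + 1), sub_zero]
      by_cases hκm : κ m = κ (i + 1)
      · -- the block of the wanted token: cancelled by the copy
        have : ¬ m + 2 ^ b ≤ i + 1 := fun h5 => by
          have := add_le_blockIndex (b := b) hqk h5
          rw [← hκ] at this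
          omega
        rw [if_pos (by omega), hκm, if_pos rfl, ← hR]
        simpa [show R * (y ^ m * D m) - y ^ m * R * D m = 0 by ring] using hpos
      · -- an earlier block: not read from the prompt, and negligible in the copy
        have h5 : κ (i + 1) ≤ κ m := blockIndex_mono hlt.le
        have hz : (if m ≤ n + 1 + i ∧ n + 1 + i ≤ m + V then
            (y ^ m * if κ m % 4 = κ (i + 1) % 4 then 1 else 0) * D m else 0) = 0 := by
          split_ifs with h6 h7
          · have := blockIndex_le_add (k := k + 1) (b := b) (m := m) (q := i + 1) (c := 2)
              (by omega)
            rw [← hκ] at this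
            omega
          · simp
          · rfl
        rw [hz, mul_zero, zero_sub, abs_neg, abs_mul, abs_of_nonneg (by positivity)]
        refine (mul_le_mul_of_nonneg_left (h.bound m) (by positivity)).trans ?_
        have h8 : r ^ κ m ≤ R * r := by
          rw [hR, ← pow_succ]
          exact pow_le_pow_of_le_one hr0.le hr1 (by omega)
        have h9 : y ^ m ≤ 1 := pow_le_one₀ hy0.le hy1
        calc y ^ m * r ^ κ m * 1 ≤ 1 * (R * r) * 1 := by gcongr
          _ ≤ 1 * (R * y ^ (i + 1 + 1)) * 1 := by gcongr
          _ = y ^ (i + 1) * R * y := by ring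
    · rw [if_neg (by omega : ¬ i + 1 ≤ i), if_pos rfl, if_pos (by omega), if_pos rfl]
      simpa [show R * (y ^ (i + 1) * D (i + 1)) - y ^ (i + 1) * R * D (i + 1) = 0 by ring]
        using hpos
    · rw [if_neg (by omega : ¬ m ≤ i), if_neg (by omega : ¬ m = i + 1), sub_zero, sub_zero]
      have h10 : y ^ m ≤ y ^ (i + 1) * y := by
        rw [← pow_succ]
        exact pow_le_pow_of_le_one hy0.le hy1 (by omega)
      have h11 : |y ^ m * D m| ≤ y ^ (i + 1) * y := by
        rw [abs_mul, abs_of_nonneg (by positivity : 0 ≤ y ^ m)]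
        refine (mul_le_mul_of_nonneg_left (h.bound m) (by positivity)).trans ?_
        rwa [mul_one]
      split_ifs
      · rw [mul_one, abs_mul, abs_of_nonneg hR0.le]
        nlinarith
      · simpa using hpos
      · simpa using hpos
  have hend : |R * ((y ^ (min (n + 1 + i) V + 1) *
      if κ (min (n + 1 + i) V + 1) % 4 = κ (i + 1) % 4 then 1 else 0) *
        taperedSucc V x (n + 1 + i - V))| ≤ y ^ (i + 1) * R * (y * (V + 1)) := by
    have h12 : |y ^ (min (n + 1 + i) V + 1) *
        (if κ (min (n + 1 + i) V + 1) % 4 = κ (i + 1) % 4 then 1 else 0)| ≤ y ^ (i + 1) * y := by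
      have : y ^ (min (n + 1 + i) V + 1) ≤ y ^ (i + 1) * y := by
        rw [← pow_succ]
        exact pow_le_pow_of_le_one hy0.le hy1 (by omega)
      split_ifs
      · rw [mul_one, abs_of_nonneg (by positivity)]
        exact this
      · rw [mul_zero, abs_zero]
        positivity
    rw [abs_mul, abs_mul, abs_of_nonneg hR0.le]
    calc _ ≤ R * (y ^ (i + 1) * y * (V + 1)) := by
          gcongr
          exact abs_taperedSucc_le hb _
      _ = _ := by ring
  rw [abs_le] at hsum hend ⊢
  constructor <;> linarith [hsum.1, hsum.2, hend.1, hend.2]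

end

section

/-! ### Convolution filters and two-block networks over an arbitrary coordinate type -/

/-- The four parameters of the filter of one coordinate. -/
structure Filter where
  /-- coefficient of the cosine -/
  c₁ : ℝ
  /-- coefficient of the sine -/
  c₂ : ℝ
  /-- frequency of the cosine -/
  a₁ : ℝ
  /-- frequency of the sine -/
  a₂ : ℝ

/-- The value of a filter at lag `j`. -/
def Filter.eval (V : ℕ) (φ : Filter) (j : ℕ) : ℝ :=
  φ.c₁ * Real.cos (2 * Real.pi * j * φ.a₁ / (V + 1)) +
    φ.c₂ * Real.sin (2 * Real.pi * j * φ.a₂ / (V + 1))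

/-- All parameters of the filter have absolute value at most `B`. -/
def Filter.BoundedBy (B : ℝ) (φ : Filter) : Prop :=
  |φ.c₁| ≤ B ∧ |φ.c₂| ≤ B ∧ |φ.a₁| ≤ B ∧ |φ.a₂| ≤ B

/-- The filter `0`. -/
def zeroFilter : Filter := ⟨0, 0, 0, 0⟩

/-- The filter `1`. -/
def oneFilter : Filter := ⟨1, 0, 0, 0⟩

/-- The filter `taper V j`. -/
def taperFilter : Filter := ⟨1, 0, 1 / 4, 0⟩

/-- The filter `taper V (j + 1)`. -/
def taperSuccFilter (V : ℕ) : Filter :=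
  ⟨Real.cos (Real.pi / (2 * (V + 1))), -Real.sin (Real.pi / (2 * (V + 1))), 1 / 4, 1 / 4⟩

/-- The angular frequency of the filters that measure distances. -/
def slowFreq (V : ℕ) : ℝ := 1 / (4 * (V + 2) ^ 2)

/-- The filter `c + sin (δ j) / δ` with the low frequency `δ = slowFreq V`, close to `c + j`. -/
def lagFilter (V : ℕ) (c : ℝ) : Filter :=
  ⟨c, 1 / slowFreq V, 0, slowFreq V * (V + 1) / (2 * Real.pi)⟩

/-- The approximation of the lag `j` that a filter can measure. -/
def lag (V j : ℕ) : ℝ := 1 / slowFreq V * Real.sin (slowFreq V * j)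

lemma eval_oneFilter (V j : ℕ) : oneFilter.eval V j = 1 := by simp [Filter.eval, oneFilter]

lemma eval_taperFilter (V j : ℕ) : taperFilter.eval V j = taper V j := by
  simp [Filter.eval, taperFilter, taper]

lemma eval_taperSuccFilter (V j : ℕ) : (taperSuccFilter V).eval V j = taper V (j + 1) := by
  have hV : (V : ℝ) + 1 ≠ 0 := by positivity
  have e : 2 * Real.pi * ((j + 1 : ℕ) : ℝ) * (1 / 4) / ((V : ℝ) + 1) =
      Real.pi / (2 * (V + 1)) + 2 * Real.pi * j * (1 / 4) / (V + 1) := by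
    push_cast
    field_simp
    ring
  rw [taper, e, Real.cos_add]
  simp only [Filter.eval, taperSuccFilter]
  ring

lemma eval_lagFilter (V : ℕ) (c : ℝ) (j : ℕ) : (lagFilter V c).eval V j = c + lag V j := by
  have hV : (V : ℝ) + 1 ≠ 0 := by positivity
  have e : 2 * Real.pi * j * (slowFreq V * (V + 1) / (2 * Real.pi)) / ((V : ℝ) + 1) =
      slowFreq V * j := by
    have := Real.pi_ne_zero
    field_simp
  simp [Filter.eval, lagFilter, lag, e]

lemma abs_lag_sub_le {V j : ℕ} (hj : j ≤ V) : |lag V j - j| ≤ 1 / (64 * (V + 2)) := by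
  set a : ℝ := (V : ℝ) + 2 with ha
  have ha2 : 2 ≤ a := by
    have : (0 : ℝ) ≤ V := by positivity
    linarith
  have hδ : slowFreq V = 1 / (4 * a ^ 2) := rfl
  have hδ0 : 0 < slowFreq V := by rw [hδ]; positivity
  have hja : (j : ℝ) ≤ a := by
    have : (j : ℝ) ≤ V := by exact_mod_cast hj
    linarith
  rcases Nat.eq_zero_or_pos j with rfl | hj0
  · simp only [lag, Nat.cast_zero, mul_zero, Real.sin_zero, sub_zero, abs_zero]
    positivity
  have hj0' : (0 : ℝ) < j := by exact_mod_cast hj0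
  have hz0 : 0 < slowFreq V * j := by positivity
  have hz1 : slowFreq V * j ≤ 1 := by
    rw [hδ, one_div, inv_mul_le_iff₀ (by positivity)]
    nlinarith
  have h1 := Real.sin_lt hz0
  have h2 := Real.sin_gt_sub_cube hz0
  have h3 : |Real.sin (slowFreq V * j) - slowFreq V * j| ≤ (slowFreq V * j) ^ 3 / 4 := by
    rw [abs_le]
    constructor <;> nlinarith [pow_pos hz0 3]
  have e : lag V j - j = 1 / slowFreq V * (Real.sin (slowFreq V * j) - slowFreq V * j) := by
    rw [lag]
    field_simp
  rw [e, abs_mul, abs_of_pos (by positivity)]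
  calc 1 / slowFreq V * |Real.sin (slowFreq V * j) - slowFreq V * j|
      ≤ 1 / slowFreq V * ((slowFreq V * j) ^ 3 / 4) := by gcongr
    _ = slowFreq V ^ 2 * j ^ 3 / 4 := by field_simp
    _ ≤ slowFreq V ^ 2 * a ^ 3 / 4 := by gcongr
    _ = 1 / (64 * a) := by
      rw [hδ]
      field_simp
      norm_num

lemma boundedBy_zeroFilter {B : ℝ} (hB : 0 ≤ B) : zeroFilter.BoundedBy B := by
  simp [Filter.BoundedBy, zeroFilter, hB]

lemma boundedBy_oneFilter {B : ℝ} (hB : 1 ≤ B) : oneFilter.BoundedBy B := by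
  have : 0 ≤ B := by linarith
  simp [Filter.BoundedBy, oneFilter, hB, this]

lemma boundedBy_taperFilter {B : ℝ} (hB : 1 ≤ B) : taperFilter.BoundedBy B := by
  have : 0 ≤ B := by linarith
  have h4 : (4 : ℝ)⁻¹ ≤ B := by linarith
  simp [Filter.BoundedBy, taperFilter, hB, this, h4]

lemma boundedBy_taperSuccFilter {B : ℝ} (V : ℕ) (hB : 1 ≤ B) :
    (taperSuccFilter V).BoundedBy B := by
  have h4 : |(1 / 4 : ℝ)| ≤ B := by rw [abs_of_pos (by norm_num)]; linarith
  refine ⟨(Real.abs_cos_le_one _).trans hB, ?_, h4, h4⟩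
  simp only [taperSuccFilter, abs_neg]
  exact (Real.abs_sin_le_one _).trans hB

lemma boundedBy_lagFilter {B : ℝ} (V : ℕ) {c : ℝ} (hc : |c| ≤ 1) (hB : 4 * ((V : ℝ) + 2) ^ 2 ≤ B) :
    (lagFilter V c).BoundedBy B := by
  have hV : (0 : ℝ) ≤ V := by positivity
  have h1 : 1 ≤ B := by nlinarith
  have hδ0 : 0 < slowFreq V := by rw [slowFreq]; positivity
  refine ⟨hc.trans h1, ?_, by simp [lagFilter]; linarith, ?_⟩
  · simp only [lagFilter]
    rw [abs_of_pos (by positivity), slowFreq, one_div_one_div]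
    exact hB
  · simp only [lagFilter]
    have hpi := Real.pi_gt_three
    rw [abs_of_pos (by positivity), div_le_iff₀ (by positivity)]
    have : slowFreq V * (V + 1) ≤ 1 := by
      rw [slowFreq, one_div, inv_mul_le_iff₀ (by positivity)]
      nlinarith
    nlinarith

variable {I : Type} [Fintype I] {α : Type*} [Fintype α]

/-- What the second block reads at position `0` of the sequence `X`: the output of the second
convolution, where the first block consists of the filters `φ₁` and the network `f₁`. -/
def secondInput (V : ℕ) (φ₁ φ₂ : I → Filter) (f₁ : (I → ℝ) → (I → ℝ)) (X : ℕ → I → ℝ) (k : I) :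
    ℝ :=
  ∑ t ∈ Finset.range (V + 1), (φ₂ k).eval V t *
    f₁ (fun k' => ∑ j ∈ Finset.range (V + 1), (φ₁ k').eval V j * X (t + j) k') k

/-- Two blocks whose convolution layers do not mix coordinates. -/
lemma exists_mem_ssmClass {V L W S : ℕ} {B : ℝ} (hB : 1 ≤ B) (E : I → α → ℝ)
    (hE : ∀ k w, |E k w| ≤ B) (φ₁ φ₂ : I → Filter) (h₁ : ∀ k, (φ₁ k).BoundedBy B)
    (h₂ : ∀ k, (φ₂ k).BoundedBy B) {f₁ f₂ : (I → ℝ) → (I → ℝ)} (hf₁ : IsReLUNet L W B f₁)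
    (hf₂ : IsReLUNet L W B f₂) (hS : L * (W * W + W) ≤ S) :
    ∃ F ∈ ssmClass α 2 V (Fintype.card I) L W S B, ∀ X k,
      F X 0 (Fintype.equivFin I k) =
        f₂ (secondInput V φ₁ φ₂ f₁ fun t k' => ∑ w, E k' w * X t w) k := by
  classical
  have hone : ∀ i j, |(1 : Matrix (Fin (Fintype.card I)) (Fin (Fintype.card I)) ℝ) i j| ≤ B := by
    intro i j
    rw [Matrix.one_apply]
    split_ifs
    · simpa using hB
    · simp; linarith
  let e := Fintype.equivFin I
  have hconv : ∀ φ : I → Filter, (∀ k, (φ k).BoundedBy B) →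
      convLayer V 1 (fun k => (φ (e.symm k)).c₁) (fun k => (φ (e.symm k)).c₂)
        (fun k => (φ (e.symm k)).a₁) (fun k => (φ (e.symm k)).a₂) ∈
        convClass V (Fintype.card I) B := fun φ hφ =>
    ⟨_, _, _, _, _, hone, fun k => (hφ _).1, fun k => (hφ _).2.1, fun k => (hφ _).2.2.1,
      fun k => (hφ _).2.2.2, rfl⟩
  refine ⟨_, ⟨fun k w => E (e.symm k) w, 0, _, ⟨_, ⟨_, rfl, _, hconv φ₁ h₁, _,
    hf₁.mem_fnnClass hS, rfl⟩, _, hconv φ₂ h₂, _, hf₂.mem_fnnClass hS, rfl⟩,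
    fun k w => hE _ _, fun _ => by simp; linarith, rfl⟩, ?_⟩
  intro X k
  simp only [convLayer, Matrix.one_mulVec, embed, add_zero, id, Equiv.symm_apply_apply, e]
  congr 1
  funext k'
  simp [secondInput, Filter.eval, convFilter, Matrix.mulVec, dotProduct]

end

section

/-! ### The first network -/

/-- The coordinates of the tokens whose number does not grow with the scales.  The first block reads
`word`, …, `cpySucc`, the second one `full`, …, `len`, and the output is `num`, `den`. -/
inductive Reg
  /-- `tapered` sum of the codes of the words -/
  | word
  /-- `taperedSucc` sum of the codes of the words -/
  | wordSucc
  /-- distance back to `bos` -/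
  | bos
  /-- distance back to `bos`, plus one -/
  | bosSucc
  /-- distance back to `copy` -/
  | cpy
  /-- distance back to `copy`, plus one -/
  | cpySucc
  /-- emission with the weight `y ^ m`, where `m` is the distance from `bos` -/
  | full
  /-- emission of `wordSucc` after `copy`, dominated by the latest token -/
  | latest
  /-- emission of `word` after `copy` -/
  | prev
  /-- emission of `wordSucc` after `copy` -/
  | prevSucc
  /-- the indicator function of the token `copy` -/
  | here
  /-- the distance from `bos`, at the token `copy` only -/
  | len
  /-- numerator of the retrieved code -/
  | num
  /-- denominator of the retrieved code -/
  | den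
  deriving DecidableEq

instance : Fintype Reg where
  elems := {.word, .wordSucc, .bos, .bosSucc, .cpy, .cpySucc, .full, .latest, .prev, .prevSucc,
    .here, .len, .num, .den}
  complete := by rintro (_ | _ | _) <;> decide

lemma card_reg : Fintype.card Reg = 14 := rfl

/-- All coordinates of the tokens.  Beyond `Reg` there are, for every scale `b`, the emissions with
the weight `y ^ m` on the blocks of length `2 ^ b` of each class modulo `4`, and the emissions by
which later copies cancel the words of a block. -/
abbrev Coord (K : ℕ) : Type := Reg ⊕ (Fin K × Fin 4) ⊕ Fin K

lemma card_coord (K : ℕ) : Fintype.card (Coord K) = 14 + (K * 4 + K) := by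
  simp [card_reg]

variable {K : ℕ}

/-- The register of the first network: the distance from `bos` or the one from `copy`. -/
def markReg : Coord K → Bool → Reg
  | .inl .full, s | .inr (.inl _), s => if s then .bosSucc else .bos
  | _, s => if s then .cpySucc else .cpy

/-- The value that the first network multiplies by a weight; `none` stands for `1`. -/
def valueReg : Coord K → Bool → Option Reg
  | .inl .here, _ => none
  | .inl .len, _ => some .bos
  | _, s => some (if s then .wordSucc else .word)

/-- The signs with which the two emissions of each coordinate enter. -/
def emitSign : Coord K → Bool → ℝ
  | .inl .full, s | .inr _, s => if s then -1 else 1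
  | .inl .here, s | .inl .len, s => if s then 1 else -1
  | .inl .latest, s | .inl .prevSucc, s => if s then 1 else 0
  | .inl .prev, s => if s then 0 else 1
  | _, _ => 0

/-- The digit factors of the weight of each coordinate. -/
def emitDigit (y : ℝ) : Coord K → ℕ → Bool → ℝ
  | .inl .full => powDigit y
  | .inl .latest => coPowDigit y
  | .inr (.inl (b, c)) => fun j t => powDigit y j t * blockClassDigit b c j t
  | .inr (.inr b) => fun j t => powDigit y j t * blockPowDigit (y ^ 2 ^ K) b j t
  | _ => fun _ _ => 1

/-- The program of the first network. -/
def emitProgram (y : ℝ) : List (Coord K × Bool → DigitStep) :=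
  (fun _ => ⟨1, 0, 0, 1⟩) :: (idleSteps (K + 2) ++ digitSteps (fun c => emitDigit y c.1) (K + 1))

lemma programWeight_emitProgram (y : ℝ) (c : Coord K × Bool) (n : ℕ) :
    programWeight (emitProgram y) c n =
      offAtZero (digitWeight (emitDigit y c.1) (K + 1)) n := by
  rw [emitProgram, programWeight, programWeight_idleSteps, programWeight_digitSteps, offAtZero]
  rcases Nat.eq_zero_or_pos n with rfl | h
  · simp
  · rw [if_pos (show 1 ≤ n from h), if_neg (by omega)]
    simp

lemma unitDigits_emitDigit {y : ℝ} (h0 : 0 ≤ y) (h1 : y ≤ 1) (k : Coord K) :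
    UnitDigits (emitDigit y k) := by
  have hp := unitDigits_powDigit h0 h1
  have hr := fun b => unitDigits_blockPowDigit b (pow_nonneg h0 (2 ^ K)) (pow_le_one₀ h0 h1)
  rcases k with k | ⟨b, c⟩ | b
  · cases k <;> first | exact hp | exact unitDigits_coPowDigit h0 h1 | exact unitDigits_one
  · exact hp.mul (unitDigits_blockClassDigit _ _)
  · exact hp.mul (hr _)

lemma length_emitProgram (y : ℝ) : (emitProgram y (K := K)).length = 2 * K + 4 := by
  simp [emitProgram, idleSteps, length_digitSteps]
  ring

/-- The network of the first block: it multiplies the tapered sums by weights depending on the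
distances from `bos` and `copy`. -/
lemma exists_firstNet {y : ℝ} (hy0 : 0 ≤ y) (hy1 : y ≤ 1) {M B : ℝ} {W : ℕ} (hM : 1 ≤ M)
    (hMB : M ≤ B) (hB : 2 * (2 : ℝ) ^ (K + 1) + 2 ≤ B) (hW : 12 * (14 + (K * 4 + K)) ≤ W) :
    ∃ f : (Coord K → ℝ) → (Coord K → ℝ), IsReLUNet (3 * (2 * K + 4) + 2) W B f ∧
      ∀ (x : Coord K → ℝ) (r r' s s' : ℕ), r < 2 ^ (K + 1) → r' < 2 ^ (K + 1) →
        s < 2 ^ (K + 1) → s' < 2 ^ (K + 1) →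
        |x (.inl .bos) - r| ≤ 1 / 4 → |x (.inl .bosSucc) - r'| ≤ 1 / 4 →
        |x (.inl .cpy) - s| ≤ 1 / 4 → |x (.inl .cpySucc) - s'| ≤ 1 / 4 →
        |x (.inl .word)| ≤ M → |x (.inl .wordSucc)| ≤ M → |x (.inl .bos)| ≤ M →
        f x (.inl .full) = offAtZero (fun m => y ^ m) r * x (.inl .word) -
          offAtZero (fun m => y ^ m) r' * x (.inl .wordSucc) ∧
        f x (.inl .latest) =
          offAtZero (fun m => y ^ (2 ^ (K + 1) - 1 - m)) s' * x (.inl .wordSucc) ∧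
        f x (.inl .prev) = offAtZero (fun _ => 1) s * x (.inl .word) ∧
        f x (.inl .prevSucc) = offAtZero (fun _ => 1) s' * x (.inl .wordSucc) ∧
        f x (.inl .here) = offAtZero (fun _ => 1) s' - offAtZero (fun _ => 1) s ∧
        f x (.inl .len) =
          (offAtZero (fun _ => 1) s' - offAtZero (fun _ => 1) s) * x (.inl .bos) ∧
        (∀ b c, f x (.inr (.inl (b, c))) =
          offAtZero (fun m => y ^ m * if blockIndex (K + 1) b m % 4 = c then 1 else 0) r *
            x (.inl .word) -
          offAtZero (fun m => y ^ m * if blockIndex (K + 1) b m % 4 = c then 1 else 0) r' *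
            x (.inl .wordSucc)) ∧
        (∀ b, f x (.inr (.inr b)) =
          offAtZero (fun m => y ^ m * (y ^ 2 ^ K) ^ blockIndex (K + 1) b m) s * x (.inl .word) -
          offAtZero (fun m => y ^ m * (y ^ 2 ^ K) ^ blockIndex (K + 1) b m) s' *
            x (.inl .wordSucc)) := by
  have hB4 : 4 ≤ B := by
    have : (2 : ℝ) ^ 0 ≤ 2 ^ (K + 1) := pow_le_pow_right₀ (by norm_num) (by omega)
    linarith
  have hunit : ∀ (k : Coord K) s, |emitSign k s| ≤ B := by
    rintro (k | k) s
    · cases k <;> cases s <;> simp [emitSign] <;> linarith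
    · cases s <;> simp [emitSign] <;> linarith
  obtain ⟨f, hf, k⟩ := exists_isReLUNet_program (C := Coord K × Bool) (μ := Coord K)
    (κ := Coord K) (W := W) (B := B) (M := M) (by linarith) hMB (by linarith)
    (by simp [card_reg]; omega) (by simp [card_reg]; omega) (by simp [card_reg]; omega)
    (emitProgram y)
    (by
      intro s hs c
      rcases List.mem_cons.1 hs with rfl | hs
      · exact ⟨by simp, by simpa using by linarith, by simp, by simp, by simp, by simp⟩
      · rcases List.mem_append.1 hs with hs | hs
        · exact admissible_of_mem_idleSteps (by linarith) hs c
        · exact admissible_of_mem_digitSteps (fun c j b => unitDigits_emitDigit hy0 hy1 c.1 j b)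
            (by linarith) hs c)
    (fun c i => if i = .inl (markReg c.1 c.2) then 1 else 0)
    (fun c i => if (valueReg c.1 c.2).map Sum.inl = some i then 1 else 0)
    (fun _ => 0) (fun c => if valueReg c.1 c.2 = none then 1 else 0)
    (fun k c => if c.1 = k then emitSign k c.2 else 0)
    (by intro c i; split_ifs <;> simp <;> linarith)
    (by intro c i; split_ifs <;> simp <;> linarith)
    (by intro c; simp; linarith)
    (by intro c; split_ifs <;> simp <;> linarith)
    (by intro k c; split_ifs <;> simp [hunit]; linarith)
  rw [length_emitProgram] at hf
  refine ⟨f, hf, ?_⟩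
  intro x r r' s s' hr hr' hs hs' hxr hxr' hxs hxs' hw hw' hb
  -- the values and the registers of the channels
  have hval : ∀ c : Coord K × Bool,
      ∑ i, (if (valueReg c.1 c.2).map Sum.inl = some i then (1 : ℝ) else 0) * x i +
        (if valueReg c.1 c.2 = none then 1 else 0) =
      (valueReg c.1 c.2).elim 1 fun j => x (.inl j) := by
    intro c
    cases valueReg c.1 c.2 <;> simp
  let n : Coord K × Bool → ℕ := fun c => match markReg c.1 c.2 with
    | .bos => r
    | .bosSucc => r'
    | .cpy => s
    | _ => s'
  have hreg : ∀ c : Coord K × Bool,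
      markReg c.1 c.2 = .bos ∨ markReg c.1 c.2 = .bosSucc ∨ markReg c.1 c.2 = .cpy ∨
        markReg c.1 c.2 = .cpySucc := by
    rintro ⟨k | k | k, s⟩
    · cases k <;> cases s <;> simp [markReg]
    · cases s <;> simp [markReg]
    · cases s <;> simp [markReg]
  have hmain := k x n
    (by
      intro c
      simp only [n]
      rcases hreg c with h | h | h | h <;> simp [h, -one_div] <;> assumption)
    (by
      intro c
      rw [hval]
      obtain ⟨k | k | k, s⟩ := c
      · cases k <;> cases s <;> simp [valueReg, hw, hw', hb, hM]
      · cases s <;> simp [valueReg, hw, hw']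
      · cases s <;> simp [valueReg, hw, hw'])
  have hsum : ∀ k : Coord K, f x k =
      emitSign k true * (offAtZero (digitWeight (emitDigit y k) (K + 1)) (n (k, true)) *
        (valueReg k true).elim 1 fun j => x (.inl j)) +
      emitSign k false * (offAtZero (digitWeight (emitDigit y k) (K + 1)) (n (k, false)) *
        (valueReg k false).elim 1 fun j => x (.inl j)) := by
    intro k
    rw [hmain]
    simp_rw [hval, programWeight_emitProgram, ite_mul, zero_mul]
    rw [Fintype.sum_prod_type, Finset.sum_eq_single k]
    · simp
    · intro k' _ hk
      simp [hk]
    · simp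
  have hcongr : ∀ {w w' : ℕ → ℝ} {m : ℕ}, w m = w' m → offAtZero w m = offAtZero w' m := by
    intro w w' m h
    simp only [offAtZero, h]
  have d1 : digitWeight (fun (_ : ℕ) (_ : Bool) => (1 : ℝ)) (K + 1) = fun _ => 1 :=
    funext fun m => digitWeight_one _ _
  have d2 : ∀ m < 2 ^ (K + 1), offAtZero (digitWeight (powDigit y) (K + 1)) m =
      offAtZero (fun m => y ^ m) m := fun m hm => hcongr (digitWeight_powDigit _ _ _ hm)
  have d3 : ∀ m < 2 ^ (K + 1), offAtZero (digitWeight (coPowDigit y) (K + 1)) m =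
      offAtZero (fun m => y ^ (2 ^ (K + 1) - 1 - m)) m :=
    fun m hm => hcongr (digitWeight_coPowDigit _ _ _ hm)
  have d4 : ∀ (b : Fin K) (c : Fin 4), ∀ m < 2 ^ (K + 1), offAtZero (digitWeight
      (fun j t => powDigit y j t * blockClassDigit b c j t) (K + 1)) m =
      offAtZero (fun m => y ^ m * if blockIndex (K + 1) b m % 4 = c then 1 else 0) m :=
    fun b c m hm => hcongr (by
      rw [digitWeight_mul, digitWeight_powDigit _ _ _ hm,
        digitWeight_blockClassDigit _ _ _ _ c.2 (by omega) hm])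
  have d5 : ∀ (b : Fin K), ∀ m < 2 ^ (K + 1), offAtZero (digitWeight
      (fun j t => powDigit y j t * blockPowDigit (y ^ 2 ^ K) b j t) (K + 1)) m =
      offAtZero (fun m => y ^ m * (y ^ 2 ^ K) ^ blockIndex (K + 1) b m) m :=
    fun b m hm => hcongr (by
      rw [digitWeight_mul, digitWeight_powDigit _ _ _ hm, digitWeight_blockPowDigit _ _ _ _ hm])
  refine ⟨?_, ?_, ?_, ?_, ?_, ?_, fun b c => ?_, fun b => ?_⟩ <;> rw [hsum] <;>
    simp only [emitSign, emitDigit, valueReg, n, markReg, d1] <;>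
    simp [d2 r hr, d2 r' hr', d3 s' hs', d4 _ _ r hr, d4 _ _ r' hr', d5 _ s hs, d5 _ s' hs'] <;>
    ring

end

section

/-! ### The second network -/

/-- The channels of the second network other than the leading emissions. -/
inductive Tail
  /-- what the copies of the preceding words emit -/
  | copies
  /-- what the current token emits -/
  | latest
  /-- the denominator -/
  | den
  deriving DecidableEq

instance : Fintype Tail where
  elems := {.copies, .latest, .den}
  complete := by rintro (_ | _ | _) <;> decide

lemma sum_tail (f : Tail → ℝ) : ∑ t, f t = f .copies + (f .latest + f .den) := by
  have : (Finset.univ : Finset Tail) = {.copies, .latest, .den} := rfl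
  rw [this, Finset.sum_insert (by decide), Finset.sum_insert (by decide), Finset.sum_singleton]

/-- The channels of the second network.  The scale `none` serves prompts whose length is the window
size `V`; the scale `b` serves those that are shorter by at least `2 ^ b` and less than
`2 ^ (b + 1)`. -/
abbrev PickChannel (K : ℕ) : Type := Option (Fin K × Fin 4) ⊕ (Option (Fin K) × Tail)

variable {K : ℕ}

/-- The scale that a channel serves. -/
def pickScale : PickChannel K → Option (Fin K)
  | .inl o => o.map Prod.fst
  | .inr c => c.1

/-- The condition on `G`, the difference of `V` and the length of the prompt, under which a scale is
used.  Here `G = V + 1` stands for the difference `0`. -/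
def ScaleActive (V : ℕ) : Option (Fin K) → ℕ → Prop
  | none, G => V + 1 ≤ G
  | some b, G => G ≤ V ∧ G < 2 ^ (b.1 + 1) ∧ 2 ^ b.1 ≤ G

/-- The digit factors of the decrease of the weight at the blocks of a scale. -/
def scaleDigit (y : ℝ) : Option (Fin K) → ℕ → Bool → ℝ
  | none => fun _ _ => 1
  | some b => blockPowDigit (y ^ 2 ^ K) b

/-- The digit factors that bring the channels of one scale to a common weight. -/
def pickDigit (y : ℝ) : PickChannel K → ℕ → Bool → ℝ
  | .inl none => coPowDigit y
  | .inl (some (b, c)) => fun j t =>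
      coPowDigit y j t * (blockPowDigit (y ^ 2 ^ K) b j t * blockClassDigit b c j t)
  | .inr (none, .copies) => fun j t => coPowDigit y j t * powDigit y j t
  | .inr (some _, .copies) => coPowDigit y
  | .inr (o, .latest) => fun j t => powDigit y j t * scaleDigit y o j t
  | .inr (o, .den) => fun j t => coPowDigit y j t * (powDigit y j t * scaleDigit y o j t)

/-- The coefficients of the value of a channel. -/
def pickRow : PickChannel K → Coord K → ℝ
  | .inl none => Pi.single (.inl .full) 1
  | .inl (some (b, c)) => Pi.single (.inr (.inl (b, c))) 1
  | .inr (none, .copies) => Pi.single (.inl .prev) 1 - Pi.single (.inl .prevSucc) 1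
  | .inr (some b, .copies) => Pi.single (.inr (.inr b)) 1
  | .inr (_, .latest) => Pi.single (.inl .latest) 1
  | .inr (_, .den) => 0

/-- The constant term of the value of a channel. -/
def pickConst : PickChannel K → ℝ
  | .inr (_, .den) => 1
  | _ => 0

/-- The coefficients with which the channels enter the two outputs. -/
def pickSign : Reg → PickChannel K → ℝ
  | .num, .inl _ => 1
  | .num, .inr (_, .copies) => -1
  | .num, .inr (_, .latest) => -1
  | .den, .inr (_, .den) => 1
  | _, _ => 0

/-- Switches a channel off unless its scale is used: three steps on the register `q + 2 ^ (K + 1) G`,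
where `q < 2 ^ (K + 1)`. -/
def selectSteps (V : ℕ) : List (PickChannel K → DigitStep) :=
  [fun c => ⟨2 ^ (K + 1) * (V + 1), 0, if pickScale c = none then 0 else 1,
      if pickScale c = none then 1 else 0⟩,
    fun c => match pickScale c with
      | none => ⟨0, 0, 1, 1⟩
      | some b => ⟨2 ^ (K + 1) * 2 ^ (b.1 + 1), 0, 1, 0⟩,
    fun c => match pickScale c with
      | none => ⟨0, 0, 1, 1⟩
      | some b => ⟨2 ^ (K + 1) * 2 ^ b.1, 0, 0, 1⟩]

/-- The program of the second network. -/
def pickProgram (V : ℕ) (y : ℝ) : List (PickChannel K → DigitStep) :=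
  selectSteps V ++ (reduceSteps (K + 1) K ++ digitSteps (pickDigit y) (K + 1))

lemma length_pickProgram (V : ℕ) (y : ℝ) : (pickProgram V y (K := K)).length = 2 * K + 4 := by
  simp [pickProgram, selectSteps, length_digitSteps, length_reduceSteps]
  ring

lemma mul_le_add_mul_iff {H a q G : ℕ} (hq : q < H) : H * a ≤ q + H * G ↔ a ≤ G := by
  constructor
  · intro h
    by_contra hlt
    have : H * (G + 1) ≤ H * a := Nat.mul_le_mul_left _ (by omega)
    rw [mul_add] at this
    omega
  · intro h
    have : H * a ≤ H * G := Nat.mul_le_mul_left _ h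
    omega

open Classical in
lemma programWeight_pickProgram {V : ℕ} (y : ℝ) (c : PickChannel K) {q G : ℕ}
    (hq : q < 2 ^ (K + 1)) (hG : G < 2 ^ K) :
    programWeight (pickProgram V y) c (q + 2 ^ (K + 1) * G) =
      if ScaleActive V (pickScale c) G then digitWeight (pickDigit y c) (K + 1) q else 0 := by
  have hrest := programWeight_reduceSteps (K + 1) K (digitSteps (pickDigit y) (K + 1)) c hq hG
  rw [programWeight_digitSteps] at hrest
  simp only [pickProgram, selectSteps, List.cons_append, List.nil_append, programWeight,
    mul_le_add_mul_iff hq]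
  cases h : pickScale c with
  | none => simp [hrest, ScaleActive]
  | some b =>
    simp only [tsub_zero, hrest, mul_le_add_mul_iff hq, reduceCtorEq, if_false]
    have hA : ScaleActive V (some b) G ↔ G ≤ V ∧ G < 2 ^ (b.1 + 1) ∧ 2 ^ b.1 ≤ G := Iff.rfl
    by_cases h1 : V + 1 ≤ G
    · rw [if_pos h1, zero_mul, if_neg (by rw [hA]; omega)]
    · by_cases h2 : 2 ^ (b.1 + 1) ≤ G
      · rw [if_neg h1, if_pos h2, zero_mul, mul_zero, if_neg (by rw [hA]; omega)]
      · by_cases h3 : 2 ^ b.1 ≤ G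
        · rw [if_neg h1, if_neg h2, if_pos h3, if_pos (by rw [hA]; omega)]
          ring
        · rw [if_neg h1, if_neg h2, if_neg h3, if_neg (by rw [hA]; omega)]
          ring

lemma unitDigits_pickDigit {y : ℝ} (h0 : 0 ≤ y) (h1 : y ≤ 1) (c : PickChannel K) :
    UnitDigits (pickDigit y c) := by
  have hp := unitDigits_powDigit h0 h1
  have he := unitDigits_coPowDigit h0 h1
  have hr := fun b => unitDigits_blockPowDigit b (pow_nonneg h0 (2 ^ K)) (pow_le_one₀ h0 h1)
  have hs : ∀ o : Option (Fin K), UnitDigits (scaleDigit y o) := by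
    rintro (_ | b)
    exacts [unitDigits_one, hr _]
  rcases c with (_ | ⟨b, c⟩) | ⟨_ | b, _ | _ | _⟩
  exacts [he, he.mul ((hr _).mul (unitDigits_blockClassDigit _ _)), he.mul hp, hp.mul (hs _),
    he.mul (hp.mul (hs _)), he, hp.mul (hs _), he.mul (hp.mul (hs _))]

lemma admissible_of_mem_selectSteps {V : ℕ} {B : ℝ} (hV : V + 2 ≤ 2 ^ K)
    (hB : 2 * (2 : ℝ) ^ (2 * K + 1) + 2 ≤ B) {s : PickChannel K → DigitStep}
    (hs : s ∈ selectSteps V) (c : PickChannel K) : (s c).Admissible B := by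
  have key : ∀ a : ℕ, a ≤ 2 ^ K → 2 * ((2 ^ (K + 1) * a : ℕ) : ℝ) + 2 ≤ B := by
    intro a ha
    have : ((2 ^ (K + 1) * a : ℕ) : ℝ) ≤ 2 ^ (2 * K + 1) := by
      have : 2 ^ (K + 1) * a ≤ 2 ^ (2 * K + 1) := by
        calc 2 ^ (K + 1) * a ≤ 2 ^ (K + 1) * 2 ^ K := Nat.mul_le_mul_left _ ha
          _ = 2 ^ (2 * K + 1) := by rw [← pow_add]; congr 1; ring
      exact_mod_cast this
    linarith
  have hB2 : 2 ≤ B := by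
    have := key 0 (by positivity)
    simpa using this
  simp only [selectSteps, List.mem_cons, List.not_mem_nil, or_false] at hs
  rcases hs with rfl | rfl | rfl
  · refine ⟨by simp, key _ (by omega), ?_, ?_, ?_, ?_⟩ <;> dsimp only <;> split_ifs <;> norm_num
  · cases h : pickScale c with
    | none => exact ⟨by simp [h], by simpa [h] using hB2, by simp [h], by simp [h], by simp [h],
        by simp [h]⟩
    | some b =>
      simp only [h]
      exact ⟨by simp, key _ (Nat.pow_le_pow_right (by norm_num) b.2), by simp, by simp, by simp,
        by simp⟩
  · cases h : pickScale c with
    | none => exact ⟨by simp [h], by simpa [h] using hB2, by simp [h], by simp [h], by simp [h],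
        by simp [h]⟩
    | some b =>
      simp only [h]
      exact ⟨by simp, key _ (Nat.pow_le_pow_right (by norm_num) b.2.le), by simp, by simp, by simp,
        by simp⟩

/-- The network of the second block: it combines the emissions read at the scale in use. -/
lemma exists_secondNet {V : ℕ} {y : ℝ} (hy0 : 0 ≤ y) (hy1 : y ≤ 1) {M B : ℝ} {W : ℕ}
    (hV : V + 2 ≤ 2 ^ K) (hM : 1 ≤ M) (hMB : M ≤ B) (hB : 2 * (2 : ℝ) ^ (2 * K + 1) + 2 ≤ B)
    (hW : 12 * (14 + (K * 4 + K)) ≤ W) :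
    ∃ f : (Coord K → ℝ) → (Coord K → ℝ), IsReLUNet (3 * (2 * K + 4) + 2) W B f ∧
      ∀ (x : Coord K → ℝ) (q G : ℕ), q < 2 ^ (K + 1) → G < 2 ^ K →
        |x (.inl .here) - 2 ^ (K + 1) * x (.inl .len) + 2 ^ (K + 1) * (V + 1) -
          (q + 2 ^ (K + 1) * G)| ≤ 1 / 4 →
        |x (.inl .full)| ≤ M → |x (.inl .latest)| ≤ M →
        |x (.inl .prev) - x (.inl .prevSucc)| ≤ M →
        (∀ b c, |x (.inr (.inl (b, c)))| ≤ M) → (∀ b, |x (.inr (.inr b))| ≤ M) →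
        (V + 1 ≤ G →
          f x (.inl .num) = y ^ (2 ^ (K + 1) - 1 - q) * x (.inl .full) -
            y ^ (2 ^ (K + 1) - 1 - q) * y ^ q * (x (.inl .prev) - x (.inl .prevSucc)) -
            y ^ q * x (.inl .latest) ∧
          f x (.inl .den) = y ^ (2 ^ (K + 1) - 1 - q) * y ^ q) ∧
        (∀ (b : Fin K) (c : Fin 4), G ≤ V → G < 2 ^ (b.1 + 1) → 2 ^ b.1 ≤ G →
          blockIndex (K + 1) b q % 4 = c →
          f x (.inl .num) = y ^ (2 ^ (K + 1) - 1 - q) * (y ^ 2 ^ K) ^ blockIndex (K + 1) b q *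
              x (.inr (.inl (b, c))) -
            y ^ (2 ^ (K + 1) - 1 - q) * x (.inr (.inr b)) -
            y ^ q * (y ^ 2 ^ K) ^ blockIndex (K + 1) b q * x (.inl .latest) ∧
          f x (.inl .den) = y ^ (2 ^ (K + 1) - 1 - q) *
            (y ^ q * (y ^ 2 ^ K) ^ blockIndex (K + 1) b q)) := by
  classical
  have hK1 : (2 : ℝ) ^ (K + 1) ≤ 2 ^ (2 * K + 1) := pow_le_pow_right₀ (by norm_num) (by omega)
  have hK2 : (2 : ℝ) ^ (K + 1) * 2 ^ K = 2 ^ (2 * K + 1) := by rw [← pow_add]; congr 1; ring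
  have hK3 : (2 : ℝ) ^ (K + 1) = 2 * 2 ^ K := by rw [pow_succ]; ring
  have hVr : (V : ℝ) + 2 ≤ 2 ^ K := by exact_mod_cast hV
  have hV0 : (0 : ℝ) ≤ V := by positivity
  have hB4 : 4 ≤ B := by nlinarith
  obtain ⟨f, hf, k⟩ := exists_isReLUNet_program (C := PickChannel K) (μ := Coord K)
    (κ := Coord K) (W := W) (B := B) (M := M) (by linarith) hMB (by linarith)
    (by
      have : Fintype.card Tail = 3 := rfl
      simp [this]; omega) (by simp [card_reg]; omega) (by simp [card_reg]; omega)
    (pickProgram V y)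
    (by
      intro s hs c
      rcases List.mem_append.1 hs with hs | hs
      · exact admissible_of_mem_selectSteps hV hB hs c
      · rcases List.mem_append.1 hs with hs | hs
        · refine admissible_of_mem_reduceSteps (r := K + 1) (k := K) ?_ hs c
          rw [pow_add, hK2]
          exact hB
        · exact admissible_of_mem_digitSteps (fun c j b => unitDigits_pickDigit hy0 hy1 c j b)
            (by linarith) hs c)
    (fun _ i => if i = .inl .here then 1 else if i = .inl .len then -2 ^ (K + 1) else 0)
    pickRow
    (fun _ => 2 ^ (K + 1) * (V + 1)) pickConst
    (fun k c => k.elim (fun r => pickSign r c) fun _ => 0)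
    (by
      intro c i
      split_ifs <;> simp <;> linarith)
    (by
      rintro ((_ | ⟨b, c⟩) | ⟨_ | b, _ | _ | _⟩) i <;>
        simp only [pickRow, Pi.sub_apply, Pi.single_apply, Pi.zero_apply] <;>
        (try split_ifs) <;> norm_num <;> linarith)
    (by
      intro c
      rw [abs_of_nonneg (by positivity)]
      nlinarith)
    (by
      rintro ((_ | ⟨b, c⟩) | ⟨_ | b, _ | _ | _⟩) <;> simp [pickConst] <;> linarith)
    (by
      rintro (r | _) c
      · rcases c with _ | ⟨_, _ | _ | _⟩ <;> cases r <;> simp [pickSign] <;> linarith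
      · simp; linarith)
  rw [length_pickProgram] at hf
  refine ⟨f, hf, ?_⟩
  intro x q G hq hG hu hfull hlat hprev hx hy
  have hval : ∀ c : PickChannel K, ∑ i, pickRow c i * x i + pickConst c = match c with
      | .inl none => x (.inl .full)
      | .inl (some (b, c)) => x (.inr (.inl (b, c)))
      | .inr (none, .copies) => x (.inl .prev) - x (.inl .prevSucc)
      | .inr (some b, .copies) => x (.inr (.inr b))
      | .inr (_, .latest) => x (.inl .latest)
      | .inr (_, .den) => 1 := by
    have hs : ∀ j : Coord K, ∑ i, (Pi.single j 1 : Coord K → ℝ) i * x i = x j := by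
      intro j
      simp [Pi.single_apply]
    rintro ((_ | ⟨b, c⟩) | ⟨_ | b, _ | _ | _⟩) <;>
      simp only [pickRow, pickConst, Pi.sub_apply, sub_mul, Finset.sum_sub_distrib, hs,
        Pi.zero_apply, zero_mul, Finset.sum_const_zero, add_zero, zero_add]
  have hmain := k x (fun _ => q + 2 ^ (K + 1) * G)
    (by
      intro c
      have : ∑ i : Coord K, (if i = .inl .here then 1 else
          if i = .inl .len then -2 ^ (K + 1) else 0) * x i =
          x (.inl .here) - 2 ^ (K + 1) * x (.inl .len) := by
        rw [Finset.sum_eq_add (.inl .here) (.inl .len) (by simp)]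
        · simp
          ring
        · rintro i - ⟨h1, h2⟩
          simp [h1, h2]
        · simp
        · simp
      rw [this]
      push_cast
      exact hu)
    (by
      intro c
      rw [hval]
      rcases c with (_ | ⟨b, c⟩) | ⟨_ | b, _ | _ | _⟩
      exacts [hfull, hx _ _, hprev, hlat, by simpa using hM, hy _, hlat, by simpa using hM])
  have hsum : ∀ r : Reg, f x (.inl r) = ∑ c : PickChannel K, pickSign r c *
      ((if ScaleActive V (pickScale c) G then digitWeight (pickDigit y c) (K + 1) q else 0) *
        (∑ i, pickRow c i * x i + pickConst c)) := by
    intro r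
    rw [hmain]
    simp_rw [programWeight_pickProgram y _ hq hG]
    rfl
  have e1 := digitWeight_powDigit y _ _ hq
  have e2 := digitWeight_coPowDigit y _ _ hq
  have e3 := fun b => digitWeight_blockPowDigit (y ^ 2 ^ K) b _ _ hq
  have e4 : ∀ (b : Fin K) (c : Fin 4), digitWeight (blockClassDigit b c) (K + 1) q =
      if blockIndex (K + 1) b q % 4 = c then 1 else 0 :=
    fun b c => digitWeight_blockClassDigit b c _ _ c.2 (by omega) hq
  have e5 := digitWeight_one (K + 1) q
  constructor
  · intro hVG
    have hno : ∀ b : Fin K, ¬ ScaleActive V (some b) G := fun b h => by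
      have := h.1
      omega
    have hyes : ScaleActive V (none : Option (Fin K)) G := hVG
    constructor <;> rw [hsum] <;> simp_rw [hval] <;>
      simp [Fintype.sum_sum_type, Fintype.sum_option, Fintype.sum_prod_type, sum_tail, pickScale,
        hno, hyes, pickSign, pickDigit, scaleDigit, digitWeight_mul, e1, e2, e5]
    ring
  · intro b c hGV hb1 hb0 hc
    have hact : ∀ b' : Fin K, ScaleActive V (some b') G ↔ b' = b := by
      intro b'
      constructor
      · rintro ⟨-, h1, h2⟩
        have h3 := (Nat.pow_lt_pow_iff_right (by norm_num : 1 < 2)).1 (h2.trans_lt hb1)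
        have h4 := (Nat.pow_lt_pow_iff_right (by norm_num : 1 < 2)).1 (hb0.trans_lt h1)
        ext
        omega
      · rintro rfl
        exact ⟨hGV, hb1, hb0⟩
    have hno : ¬ ScaleActive V (none : Option (Fin K)) G := fun h => by
      have : V + 1 ≤ G := h
      omega
    have hcc : ∀ c' : Fin 4, blockIndex (K + 1) b q % 4 = c' ↔ c' = c := by
      intro c'
      rw [hc, Fin.val_inj, eq_comm]
    constructor <;> rw [hsum] <;> simp_rw [hval] <;>
      simp [Fintype.sum_sum_type, Fintype.sum_option, Fintype.sum_prod_type, sum_tail, pickScale,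
        hno, hact, pickSign, pickDigit, scaleDigit, digitWeight_mul, e1, e2, e3, e4, hcc,
        Finset.sum_add_distrib]
    ring

end

section

/-! ### Retrieval by the two blocks -/

variable {K : ℕ}

/-- The filters of the first block. -/
def firstFilter (V : ℕ) : Coord K → Filter
  | .inl .word => taperFilter
  | .inl .wordSucc => taperSuccFilter V
  | .inl .bos | .inl .cpy => lagFilter V 0
  | .inl .bosSucc | .inl .cpySucc => lagFilter V 1
  | _ => zeroFilter

/-- The filters of the second block. -/
def secondFilter (V : ℕ) : Coord K → Filter
  | .inl .full | .inl .latest | .inl .len | .inr _ => oneFilter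
  | .inl .prev => taperSuccFilter V
  | .inl .prevSucc => taperFilter
  | .inl .here => lagFilter V 1
  | _ => zeroFilter

lemma boundedBy_firstFilter {V : ℕ} {B : ℝ} (hB : 4 * ((V : ℝ) + 2) ^ 2 ≤ B) (k : Coord K) :
    (firstFilter V k).BoundedBy B := by
  have hV : (0 : ℝ) ≤ V := by positivity
  have h1 : 1 ≤ B := by nlinarith
  have h0 := boundedBy_zeroFilter (B := B) (by linarith)
  have h2 := boundedBy_taperFilter h1
  have h3 := boundedBy_taperSuccFilter V h1
  have h4 := boundedBy_lagFilter V (c := 0) (by simp) hB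
  have h5 := boundedBy_lagFilter V (c := 1) (by simp) hB
  rcases k with k | k
  · cases k <;> assumption
  · exact h0

lemma boundedBy_secondFilter {V : ℕ} {B : ℝ} (hB : 4 * ((V : ℝ) + 2) ^ 2 ≤ B) (k : Coord K) :
    (secondFilter V k).BoundedBy B := by
  have hV : (0 : ℝ) ≤ V := by positivity
  have h1 : 1 ≤ B := by nlinarith
  have h0 := boundedBy_zeroFilter (B := B) (by linarith)
  have h2 := boundedBy_taperFilter h1
  have h3 := boundedBy_taperSuccFilter V h1
  have h4 := boundedBy_oneFilter h1
  have h5 := boundedBy_lagFilter V (c := 1) (by simp) hB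
  rcases k with k | k
  · cases k <;> assumption
  · exact h4

/-- The embedded tokens of `bos x₁ ⋯ xₙ copy x₁ ⋯ xᵢ`, where `D` are the codes of the words. -/
structure IsCopyInput (n i : ℕ) (D : ℕ → ℝ) (X : ℕ → Coord K → ℝ) : Prop where
  word : ∀ t, X t (.inl .word) = backward D (n + 1 + i) t
  wordSucc : ∀ t, X t (.inl .wordSucc) = backward D (n + 1 + i) t
  bos : ∀ t, X t (.inl .bos) = if t = n + 1 + i then 1 else 0
  bosSucc : ∀ t, X t (.inl .bosSucc) = if t = n + 1 + i then 1 else 0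
  cpy : ∀ t, X t (.inl .cpy) = if t = i then 1 else 0
  cpySucc : ∀ t, X t (.inl .cpySucc) = if t = i then 1 else 0

lemma sum_filter_mark (V p t : ℕ) (F : ℕ → ℝ) :
    ∑ j ∈ Finset.range (V + 1), F j * (if t + j = p then 1 else 0) =
      if t ≤ p ∧ p ≤ t + V then F (p - t) else 0 := by
  split_ifs with h
  · rw [Finset.sum_eq_single (p - t)]
    · rw [if_pos (by omega), mul_one]
    · intro j _ hj
      rw [if_neg (by omega), mul_zero]
    · intro hj
      exact absurd (Finset.mem_range.2 (by omega)) hj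
  · refine Finset.sum_eq_zero fun j hj => ?_
    have := Finset.mem_range.1 hj
    rw [if_neg (by omega), mul_zero]

lemma abs_readout_le {V : ℕ} {w : ℕ → ℝ} (hw : ∀ m, |w m| ≤ 1) (p : ℕ) {x : ℕ → ℝ}
    (hx : ∀ t, |x t| ≤ 1) : |readout V w p x| ≤ (V + 1) * (2 * (V + 1)) := by
  refine (Finset.abs_sum_le_sum_abs _ _).trans ?_
  refine (Finset.sum_le_card_nsmul _ _ (2 * ((V : ℝ) + 1)) fun t _ => ?_).trans (by simp)
  have h1 : ∀ a b : ℝ, |a| ≤ 1 → |b| ≤ V + 1 → |a * b| ≤ V + 1 := fun a b ha hb => by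
    rw [abs_mul]
    nlinarith [abs_nonneg a, abs_nonneg b]
  have h2 := h1 _ _ (hw (markDist V p t)) (abs_tapered_le hx t (V := V))
  have h3 := h1 _ _ (hw (markDistSucc V p t)) (abs_taperedSucc_le hx t (V := V))
  have := abs_sub (w (markDist V p t) * tapered V x t)
    (w (markDistSucc V p t) * taperedSucc V x t)
  linarith

lemma abs_offAtZero_le {w : ℕ → ℝ} (hw : ∀ m, |w m| ≤ 1) (m : ℕ) : |offAtZero w m| ≤ 1 := by
  unfold offAtZero
  split_ifs
  exacts [by simp, hw m]

lemma abs_sum_mul_le {V : ℕ} {c w x : ℕ → ℝ} {M : ℝ} (hc : ∀ t, |c t| ≤ 1) (hw : ∀ t, |w t| ≤ 1)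
    (hx : ∀ t, |x t| ≤ M) :
    |∑ t ∈ Finset.range (V + 1), c t * (w t * x t)| ≤ (V + 1) * M := by
  refine (Finset.abs_sum_le_sum_abs _ _).trans ?_
  refine (Finset.sum_le_card_nsmul _ _ M fun t _ => ?_).trans (by simp)
  rw [abs_mul, abs_mul]
  calc |c t| * (|w t| * |x t|) ≤ 1 * (1 * M) := by
        gcongr
        exacts [hc t, hw t, hx t]
    _ = M := by ring

/-- The copy signal is continued correctly: up to a relative error of order `y`, the quotient of the
two outputs is the code of the word that has to be copied next. -/
lemma exists_retrieval {V : ℕ} {y : ℝ} (hy0 : 0 < y) (hy1 : y ≤ 1) {B : ℝ} {W : ℕ}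
    (hK : V + 2 ≤ 2 ^ K) (hK' : 2 ^ (K + 1) ≤ 4 * (V + 2)) (hB : 100 * ((V : ℝ) + 2) ^ 2 ≤ B)
    (hW : 12 * (14 + (K * 4 + K)) ≤ W) :
    ∃ f₁ f₂ : (Coord K → ℝ) → (Coord K → ℝ), IsReLUNet (3 * (2 * K + 4) + 2) W B f₁ ∧
      IsReLUNet (3 * (2 * K + 4) + 2) W B f₂ ∧
      ∀ (n i : ℕ) (D : ℕ → ℝ) (X : ℕ → Coord K → ℝ), CopySignal V n i D → IsCopyInput n i D X →
        0 < f₂ (secondInput V (firstFilter V) (secondFilter V) f₁ X) (.inl .den) ∧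
        |f₂ (secondInput V (firstFilter V) (secondFilter V) f₁ X) (.inl .num) -
            f₂ (secondInput V (firstFilter V) (secondFilter V) f₁ X) (.inl .den) * D (i + 1)| ≤
          f₂ (secondInput V (firstFilter V) (secondFilter V) f₁ X) (.inl .den) *
            (y * (V + 2) ^ 2) := by
  have hV0 : (0 : ℝ) ≤ V := by positivity
  have hKr : (2 : ℝ) ^ (K + 1) ≤ 4 * (V + 2) := by exact_mod_cast hK'
  have hKK : 2 * (2 : ℝ) ^ (2 * K + 1) + 2 ≤ B := by
    have e : 2 * (2 : ℝ) ^ (2 * K + 1) = 2 ^ (K + 1) * 2 ^ (K + 1) := by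
      rw [← pow_add, ← pow_succ']
      congr 1
      ring
    have : (2 : ℝ) ^ (K + 1) * 2 ^ (K + 1) ≤ 4 * (V + 2) * (4 * (V + 2)) := by gcongr
    nlinarith
  have hK1 : 2 * (2 : ℝ) ^ (K + 1) + 2 ≤ B := by
    have : (2 : ℝ) ^ (K + 1) ≤ 2 ^ (2 * K + 1) := pow_le_pow_right₀ (by norm_num) (by omega)
    linarith
  set M : ℝ := 4 * ((V : ℝ) + 2) ^ 2 with hM
  have hM1 : 1 ≤ M := by nlinarith
  have hMB : M ≤ B := by nlinarith
  have hMV : (V : ℝ) + 1 ≤ M := by nlinarith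
  obtain ⟨f₁, hf₁, k₁⟩ := exists_firstNet (K := K) hy0.le hy1 hM1 hMB hK1 hW
  obtain ⟨f₂, hf₂, k₂⟩ := exists_secondNet (K := K) hy0.le hy1 hK hM1 hMB hKK hW
  refine ⟨f₁, f₂, hf₁, hf₂, ?_⟩
  intro n i D X hD hX
  have hn := hD.le
  have hi := hD.lt
  set p := n + 1 + i with hp
  set x := backward D p with hx
  have hx1 : ∀ t, |x t| ≤ 1 := abs_backward_le hD.bound p
  have hpk : 2 ^ (K + 1) = 2 * 2 ^ K := by rw [pow_succ]; ring
  have hε : 1 / (64 * ((V : ℝ) + 2)) ≤ 1 / 128 := by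
    apply one_div_le_one_div_of_le <;> linarith
  -- what the first convolution computes
  set u : ℕ → Coord K → ℝ := fun t k' =>
    ∑ j ∈ Finset.range (V + 1), (firstFilter V k').eval V j * X (t + j) k' with hu
  have u_word : ∀ t, u t (.inl .word) = tapered V x t := fun t => by
    simp only [hu, firstFilter, eval_taperFilter, hX.word, tapered, hx, hp]
  have u_wordSucc : ∀ t, u t (.inl .wordSucc) = taperedSucc V x t := fun t => by
    simp only [hu, firstFilter, eval_taperSuccFilter, hX.wordSucc, taperedSucc, hx, hp]
  have u_bos : ∀ t, u t (.inl .bos) = if t ≤ p ∧ p ≤ t + V then lag V (p - t) else 0 := fun t => by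
    simp only [hu, firstFilter, eval_lagFilter, hX.bos, sum_filter_mark, zero_add, ← hp]
  have u_bosSucc : ∀ t, u t (.inl .bosSucc) =
      if t ≤ p ∧ p ≤ t + V then 1 + lag V (p - t) else 0 := fun t => by
    simp only [hu, firstFilter, eval_lagFilter, hX.bosSucc, ← hp]
    exact sum_filter_mark V p t fun j => 1 + lag V j
  have u_cpy : ∀ t, u t (.inl .cpy) = if t ≤ i ∧ i ≤ t + V then lag V (i - t) else 0 := fun t => by
    simp only [hu, firstFilter, eval_lagFilter, hX.cpy, sum_filter_mark, zero_add]
  have u_cpySucc : ∀ t, u t (.inl .cpySucc) =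
      if t ≤ i ∧ i ≤ t + V then 1 + lag V (i - t) else 0 := fun t => by
    simp only [hu, firstFilter, eval_lagFilter, hX.cpySucc]
    exact sum_filter_mark V i t fun j => 1 + lag V j
  have hdist : ∀ p t, |(if t ≤ p ∧ p ≤ t + V then lag V (p - t) else 0) - (markDist V p t : ℝ)| ≤
      1 / (64 * (V + 2)) := by
    intro p t
    unfold markDist
    split_ifs
    · exact abs_lag_sub_le (by omega)
    · simp only [Nat.cast_zero, sub_zero, abs_zero]
      positivity
  have hdistSucc : ∀ p t, |(if t ≤ p ∧ p ≤ t + V then 1 + lag V (p - t) else 0) -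
      (markDistSucc V p t : ℝ)| ≤ 1 / (64 * (V + 2)) := by
    intro p t
    unfold markDistSucc
    split_ifs
    · have := abs_lag_sub_le (V := V) (j := p - t) (by omega)
      rw [Nat.cast_add, Nat.cast_one]
      convert this using 2
      ring
    · simp only [Nat.cast_zero, sub_zero, abs_zero]
      positivity
  have hlt : ∀ p t, markDist V p t < 2 ^ (K + 1) := by
    intro p t
    unfold markDist
    split_ifs <;> omega
  have hltSucc : ∀ p t, markDistSucc V p t < 2 ^ (K + 1) := by
    intro p t
    unfold markDistSucc
    split_ifs <;> omega
  have hbosM : ∀ t, |u t (.inl .bos)| ≤ M := by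
    intro t
    have h1 := hdist p t
    rw [← u_bos] at h1
    have h2 : (markDist V p t : ℝ) ≤ V := by
      have : markDist V p t ≤ V := by
        unfold markDist
        split_ifs <;> omega
      exact_mod_cast this
    have h3 : (0 : ℝ) ≤ markDist V p t := by positivity
    rw [abs_le] at h1 ⊢
    constructor <;> linarith [h1.1, h1.2]
  have hfirst := fun t => k₁ (u t) (markDist V p t) (markDistSucc V p t) (markDist V i t)
    (markDistSucc V i t) (hlt p t) (hltSucc p t) (hlt i t) (hltSucc i t)
    (by rw [u_bos]; exact (hdist p t).trans (by linarith))
    (by rw [u_bosSucc]; exact (hdistSucc p t).trans (by linarith))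
    (by rw [u_cpy]; exact (hdist i t).trans (by linarith))
    (by rw [u_cpySucc]; exact (hdistSucc i t).trans (by linarith))
    (by rw [u_word]; exact (abs_tapered_le hx1 t).trans hMV)
    (by rw [u_wordSucc]; exact (abs_taperedSucc_le hx1 t).trans hMV)
    (hbosM t)
  simp only [u_word, u_wordSucc] at hfirst
  have hmark : ∀ t, offAtZero (fun _ => 1) (markDistSucc V i t) -
      offAtZero (fun _ => 1) (markDist V i t) = if i = t then 1 else 0 := by
    intro t
    unfold markDist markDistSucc offAtZero
    by_cases h1 : i = t
    · subst h1
      simp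
    · by_cases h2 : t ≤ i ∧ i ≤ t + V
      · have : i - t ≠ 0 := by omega
        simp [h1, h2, this]
      · simp [h1, h2]
  -- what the second block reads
  set z := secondInput V (firstFilter V) (secondFilter V) f₁ X with hz
  have z_def : ∀ k, z k = ∑ t ∈ Finset.range (V + 1), (secondFilter V k).eval V t * f₁ (u t) k :=
    fun k => rfl
  have z_full : z (.inl .full) = readout V (offAtZero fun m => y ^ m) p x := by
    simp only [z_def, secondFilter, eval_oneFilter, (hfirst _).1, one_mul, readout]
  have z_latest : z (.inl .latest) = ∑ t ∈ Finset.range (V + 1),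
      offAtZero (fun m => y ^ (2 ^ (K + 1) - 1 - m)) (markDistSucc V i t) * taperedSucc V x t := by
    simp only [z_def, secondFilter, eval_oneFilter, (hfirst _).2.1, one_mul]
  have z_prev : z (.inl .prev) = ∑ t ∈ Finset.range (V + 1), taper V (t + 1) *
      (offAtZero (fun _ => 1) (markDist V i t) * tapered V x t) := by
    simp only [z_def, secondFilter, eval_taperSuccFilter, (hfirst _).2.2.1]
  have z_prevSucc : z (.inl .prevSucc) = ∑ t ∈ Finset.range (V + 1), taper V t *
      (offAtZero (fun _ => 1) (markDistSucc V i t) * taperedSucc V x t) := by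
    simp only [z_def, secondFilter, eval_taperFilter, (hfirst _).2.2.2.1]
  have z_here : z (.inl .here) = 1 + lag V i := by
    simp only [z_def, secondFilter, eval_lagFilter, (hfirst _).2.2.2.2.1, hmark]
    rw [Finset.sum_eq_single i]
    · simp
    · intro t _ ht
      simp [Ne.symm ht]
    · intro h
      exact absurd (Finset.mem_range.2 (by omega)) h
  have z_len : z (.inl .len) = if n + 1 ≤ V then lag V (n + 1) else 0 := by
    simp only [z_def, secondFilter, eval_oneFilter, (hfirst _).2.2.2.2.2.1, hmark, u_bos]
    rw [Finset.sum_eq_single i]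
    · rw [if_pos rfl, one_mul, one_mul, show p - i = n + 1 by omega]
      congr 1
      simp only [eq_iff_iff]
      omega
    · intro t _ ht
      simp [Ne.symm ht]
    · intro h
      exact absurd (Finset.mem_range.2 (by omega)) h
  have z_block : ∀ b c, z (.inr (.inl (b, c))) = readout V (offAtZero fun m => y ^ m *
      if blockIndex (K + 1) b m % 4 = c then 1 else 0) p x := fun b c => by
    simp only [z_def, secondFilter, eval_oneFilter, (hfirst _).2.2.2.2.2.2.1, one_mul, readout]
  have z_copies : ∀ b, z (.inr (.inr b)) = readout V (offAtZero fun m => y ^ m *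
      (y ^ 2 ^ K) ^ blockIndex (K + 1) b m) i x := fun b => by
    simp only [z_def, secondFilter, eval_oneFilter, (hfirst _).2.2.2.2.2.2.2, one_mul, readout]
  -- the register of the second network
  set G : ℕ := if n + 1 ≤ V then V - n else V + 1 with hG
  have hGK : G < 2 ^ K := by
    rw [hG]
    split_ifs <;> omega
  have hreg : |z (.inl .here) - 2 ^ (K + 1) * z (.inl .len) + 2 ^ (K + 1) * (V + 1) -
      (((i + 1 : ℕ) : ℝ) + 2 ^ (K + 1) * G)| ≤ 1 / 4 := by
    have h1 := abs_le.1 (abs_lag_sub_le (V := V) (j := i) (by omega))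
    rw [z_here, z_len, hG]
    split_ifs with h
    · have h2 := abs_lag_sub_le (V := V) (j := n + 1) h
      have h3 : |2 ^ (K + 1) * (lag V (n + 1) - ((n + 1 : ℕ) : ℝ))| ≤ 1 / 16 := by
        rw [abs_mul, abs_of_pos (by positivity)]
        calc (2 : ℝ) ^ (K + 1) * |lag V (n + 1) - ((n + 1 : ℕ) : ℝ)|
            ≤ 4 * (V + 2) * (1 / (64 * (V + 2))) := by gcongr
          _ = 1 / 16 := by
            field_simp
            norm_num
      have h4 := abs_le.1 h3
      rw [Nat.cast_sub hn, abs_le]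
      push_cast at *
      constructor <;> linarith [h1.1, h1.2, h4.1, h4.2]
    · rw [abs_le]
      push_cast
      constructor <;> linarith [h1.1, h1.2]
  -- the values of the second network
  have hpow : ∀ m, |y ^ m| ≤ 1 := fun m => by
    rw [abs_of_nonneg (by positivity)]
    exact pow_le_one₀ hy0.le hy1
  have hR : ∀ b m, |y ^ m * (y ^ 2 ^ K) ^ blockIndex (K + 1) b m| ≤ 1 := fun b m => by
    rw [← pow_mul, ← pow_add]
    exact hpow _
  have hcls : ∀ b c m, |y ^ m * if blockIndex (K + 1) b m % 4 = c then 1 else 0| ≤ 1 :=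
      fun b c m => by
    split_ifs
    · rw [mul_one]
      exact hpow m
    · simp
  have hMM : ((V : ℝ) + 1) * (2 * (V + 1)) ≤ M := by nlinarith
  have hMM' : ((V : ℝ) + 1) * (V + 1) ≤ M / 2 := by nlinarith
  obtain ⟨hcase₁, hcase₂⟩ := k₂ z (i + 1) G (by omega) hGK hreg
    (by
      rw [z_full]
      exact (abs_readout_le (abs_offAtZero_le hpow) p hx1).trans hMM)
    (by
      rw [z_latest]
      have := abs_sum_mul_le (V := V) (c := fun _ => 1)
        (w := fun t => offAtZero (fun m => y ^ (2 ^ (K + 1) - 1 - m)) (markDistSucc V i t))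
        (x := taperedSucc V x) (M := V + 1) (by simp)
        (fun t => abs_offAtZero_le (fun m => hpow _) _) (abs_taperedSucc_le hx1)
      simp only [one_mul] at this
      linarith)
    (by
      rw [z_prev, z_prevSucc]
      have h1 := abs_sum_mul_le (V := V) (c := fun t => taper V (t + 1))
        (w := fun t => offAtZero (fun _ => 1) (markDist V i t))
        (x := tapered V x) (M := V + 1) (fun t => abs_taper_le _ _)
        (fun t => abs_offAtZero_le (fun m => by simp) _) (abs_tapered_le hx1)
      have h2 := abs_sum_mul_le (V := V) (c := fun t => taper V t)
        (w := fun t => offAtZero (fun _ => 1) (markDistSucc V i t))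
        (x := taperedSucc V x) (M := V + 1) (fun t => abs_taper_le _ _)
        (fun t => abs_offAtZero_le (fun m => by simp) _) (abs_taperedSucc_le hx1)
      rw [abs_le] at h1 h2 ⊢
      constructor <;> linarith [h1.1, h1.2, h2.1, h2.2])
    (fun b c => by
      rw [z_block]
      exact (abs_readout_le (abs_offAtZero_le (hcls _ _)) p hx1).trans hMM)
    (fun b => by
      rw [z_copies]
      exact (abs_readout_le (abs_offAtZero_le (hR _)) i hx1).trans hMM)
  have hlatest := hD.abs_latest_sub_le hy0 hy1 (H := 2 ^ (K + 1)) (by omega)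
  rw [← hp, ← hx, ← z_latest] at hlatest
  set η := y ^ (2 ^ (K + 1) - 1 - (i + 1)) with hη
  have hη0 : 0 < η := by positivity
  set T := taperedSucc V x 0 with hT
  -- both cases combine the estimate of the leading emissions with that of the latest one
  have hcombine : ∀ s A : ℝ, 0 < s →
      |A - s * T - s * D (i + 1)| ≤ s * (y * (2 * (V + 1))) →
      |η * A - s * z (.inl .latest) - η * s * D (i + 1)| ≤ η * s * (y * (V + 2) ^ 2) := by
    intro s A hs hA
    have e : η * A - s * z (.inl .latest) - η * s * D (i + 1) =
        η * (A - s * T - s * D (i + 1)) - s * (z (.inl .latest) - η * T) := by ring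
    have h1 : |η * (A - s * T - s * D (i + 1))| ≤ η * (s * (y * (2 * (V + 1)))) := by
      rw [abs_mul, abs_of_pos hη0]
      gcongr
    have h2 : |s * (z (.inl .latest) - η * T)| ≤ s * (η * (y * (V * (V + 1)))) := by
      rw [abs_mul, abs_of_pos hs]
      gcongr
    have h3 : η * (s * (y * (2 * (V + 1)))) + s * (η * (y * (V * (V + 1)))) ≤
        η * s * (y * (V + 2) ^ 2) := by
      have : 0 ≤ η * s * y := by positivity
      nlinarith
    rw [e]
    exact (abs_sub _ _).trans (by linarith)
  by_cases hnV : n + 1 ≤ V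
  · have hGn : G = V - n := by rw [hG, if_pos hnV]
    have hg0 : V - n ≠ 0 := by omega
    have hb0 : 2 ^ Nat.log 2 (V - n) ≤ V - n := Nat.pow_log_le_self 2 hg0
    have hb1 : V - n < 2 ^ (Nat.log 2 (V - n) + 1) := Nat.lt_pow_succ_log_self (by norm_num) _
    have hbK : Nat.log 2 (V - n) < K := by
      rw [← Nat.pow_lt_pow_iff_right (by norm_num : 1 < 2)]
      omega
    generalize Nat.log 2 (V - n) = b at *
    obtain ⟨hnum, hden⟩ := hcase₂ ⟨b, hbK⟩
      ⟨blockIndex (K + 1) b (i + 1) % 4, Nat.mod_lt _ (by norm_num)⟩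
      (by omega) (by rw [hGn]; exact hb1) (by rw [hGn]; exact hb0) rfl
    have hest := hD.abs_block_sub_le hy0 hy1 hK hb0 hb1
    rw [z_block, z_copies] at hnum
    rw [← hp, ← hx, ← hT] at hest
    dsimp only at hnum hden hest
    set R := (y ^ 2 ^ K) ^ blockIndex (K + 1) b (i + 1) with hRdef
    have hR0 : 0 < R := by positivity
    rw [hnum, hden]
    refine ⟨by positivity, ?_⟩
    convert hcombine (y ^ (i + 1) * R) _ (by positivity) hest using 2
    ring
  · obtain rfl : n = V := by omega
    obtain ⟨hnum, hden⟩ := hcase₁ (by rw [hG, if_neg hnV])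
    have hest := hD.abs_full_sub_le hy0 hy1
    rw [← hp, ← hx, ← hT, ← z_prev, ← z_prevSucc, ← z_full] at hest
    rw [hnum, hden]
    refine ⟨by positivity, ?_⟩
    convert hcombine (y ^ (i + 1)) _ (by positivity) hest using 2
    ring

end

section

/-! ### From words to signals and back -/

variable {α : Type*}

/-- The text `bos x₁ ⋯ xₙ copy x₁ ⋯ xᵢ` for `l = [x₁, …, xₙ]`. -/
def copyText (bos copy : α) (l : List α) (i : ℕ) : List α := bos :: (l ++ [copy]) ++ l.take i

/-- The codes `e` of the words of a text, continued by `0`. -/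
def textSignal (e : α → ℝ) (s : List α) (m : ℕ) : ℝ := (s[m]?).elim 0 e

section

variable {bos copy : α} {l : List α} {i : ℕ} (e : α → ℝ)

lemma length_copyText (hi : i ≤ l.length) :
    (copyText bos copy l i).length = l.length + 1 + i + 1 := by
  simp [copyText, hi]
  omega

lemma textSignal_copyText_zero : textSignal e (copyText bos copy l i) 0 = e bos := rfl

lemma getElem?_copyText_of_lt {m : ℕ} (hm : m < l.length) :
    (copyText bos copy l i)[m + 1]? = l[m]? := by
  simp [copyText, List.getElem?_append, hm]

lemma textSignal_copyText_copy : textSignal e (copyText bos copy l i) (l.length + 1) = e copy := by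
  simp [copyText, textSignal]

lemma getElem?_copyText_of_le (m : ℕ) :
    (copyText bos copy l i)[l.length + 1 + (m + 1)]? = (l.take i)[m]? := by
  rw [copyText, List.getElem?_append_right (by simp)]
  congr 1
  simp
  omega

lemma textSignal_copyText_rep {m : ℕ} (hm : 1 ≤ m) (hmi : m ≤ i) (hi : i ≤ l.length) :
    textSignal e (copyText bos copy l i) (l.length + 1 + m) =
      textSignal e (copyText bos copy l i) m := by
  obtain ⟨m, rfl⟩ : ∃ k, m = k + 1 := ⟨m - 1, by omega⟩
  rw [textSignal, textSignal, getElem?_copyText_of_le, getElem?_copyText_of_lt (by omega),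
    List.getElem?_take_of_lt (by omega)]

/-- As `bos` and `copy` occur only once, their indicator functions mark their positions. -/
lemma textSignal_indicator_bos [DecidableEq α] (hne : bos ≠ copy) (hl : bos ∉ l) (m : ℕ) :
    textSignal (fun w => if w = bos then 1 else 0) (copyText bos copy l i) m =
      if m = 0 then 1 else 0 := by
  rcases Nat.eq_zero_or_pos m with rfl | hm
  · simp [textSignal_copyText_zero]
  · obtain ⟨m, rfl⟩ : ∃ k, m = k + 1 := ⟨m - 1, by omega⟩
    rw [if_neg (by omega), textSignal]
    cases h : (copyText bos copy l i)[m + 1]? with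
    | none => rfl
    | some w =>
      have hw : w ∈ l ++ [copy] ++ l.take i :=
        List.mem_of_getElem? (i := m) (by simpa [copyText] using h)
      have : w ≠ bos := by
        rintro rfl
        simp only [List.mem_append, List.mem_singleton] at hw
        rcases hw with (hw | hw) | hw
        exacts [hl hw, hne hw, hl (List.mem_of_mem_take hw)]
      simp [this]

lemma textSignal_indicator_copy [DecidableEq α] (hne : bos ≠ copy) (hl : copy ∉ l) (m : ℕ) :
    textSignal (fun w => if w = copy then 1 else 0) (copyText bos copy l i) m =
      if m = l.length + 1 then 1 else 0 := by
  have hcontent : ∀ o : Option α, (∀ w ∈ o, w ∈ l) →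
      (o.elim 0 fun w => if w = copy then (1 : ℝ) else 0) = 0 := by
    intro o ho
    cases o with
    | none => rfl
    | some w =>
      have : w ≠ copy := fun h => hl (h ▸ ho w rfl)
      simp [this]
  rcases lt_trichotomy m (l.length + 1) with h | rfl | h
  · rw [if_neg h.ne]
    rcases Nat.eq_zero_or_pos m with rfl | hm
    · simp [textSignal_copyText_zero, hne]
    · obtain ⟨m, rfl⟩ : ∃ k, m = k + 1 := ⟨m - 1, by omega⟩
      rw [textSignal, getElem?_copyText_of_lt (by omega)]
      exact hcontent _ fun w hw => List.mem_of_getElem? hw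
  · simp [textSignal_copyText_copy]
  · rw [if_neg h.ne']
    obtain ⟨m, rfl⟩ : ∃ k, m = l.length + 1 + (k + 1) := ⟨m - l.length - 2, by omega⟩
    rw [textSignal, getElem?_copyText_of_le]
    exact hcontent _ fun w hw => List.mem_of_mem_take (List.mem_of_getElem? hw)

variable [Fintype α] [DecidableEq α]

lemma sum_mul_oneHot {s : List α} {p : ℕ} (hs : s.length = p + 1) (t : ℕ) :
    ∑ w, e w * oneHot s t w = backward (textSignal e s) p t := by
  unfold backward
  split_ifs with h
  · have hr : s.reverse[t]? = s[p - t]? := by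
      rw [List.getElem?_reverse (by omega), hs]
      congr 1
    rw [textSignal, oneHot, hr]
    cases s[p - t]? <;> simp [Pi.single_apply]
  · have hr : s.reverse[t]? = none := by simp; omega
    simp [oneHot, hr]

end

lemma generate_eq_take {next : List α → Option α} {s l : List α}
    (h : ∀ i < l.length, next (s ++ l.take i) = l[i]?) {k : ℕ} (hk : k ≤ l.length) :
    generate next s k = some (l.take k) := by
  induction k with
  | zero => simp [generate]
  | succ k ih =>
    rw [generate, ih (by omega), Option.bind_some, h k (by omega),
      List.getElem?_eq_getElem (by omega), Option.map_some, List.take_append_getElem]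

/-- The nearest point on a parabola is found by a linear functional: the scores
`κ * num - κ ^ 2 / 2 * den` compare like the distances of `κ` from `num / den`. -/
lemma parabola_lt {N κ κ' num den : ℝ} (hN : 0 < N) (hden : 0 < den) (hκ : 1 / N ≤ |κ - κ'|)
    (h : |num - den * κ| ≤ den * (1 / (4 * N))) :
    κ' * num - κ' ^ 2 / 2 * den < κ * num - κ ^ 2 / 2 * den := by
  have hpos : 0 < 1 / N := by positivity
  have h1 : |(κ - κ') * (num - den * κ)| ≤ |κ - κ'| * (den * (1 / (4 * N))) := by
    rw [abs_mul]
    gcongr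
  have h2 : den * (1 / (4 * N)) < den * (|κ - κ'| / 2) := by
    have : 1 / (4 * N) = 1 / N / 4 := by rw [div_div, mul_comm]
    refine mul_lt_mul_of_pos_left ?_ hden
    linarith
  have h3 : |κ - κ'| * (den * (1 / (4 * N))) < |κ - κ'| * (den * (|κ - κ'| / 2)) := by
    gcongr
    linarith
  have h4 : |κ - κ'| * (den * (|κ - κ'| / 2)) = den * ((κ - κ') ^ 2 / 2) := by
    rw [← sq_abs]
    ring
  have h5 := neg_abs_le ((κ - κ') * (num - den * κ))
  nlinarith

section

variable [Fintype α]

/-- The words as equidistant points of `[0, 1)`. -/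
def wordPoint (w : α) : ℝ := (Fintype.equivFin α w : ℕ) / Fintype.card α

lemma wordPoint_nonneg (w : α) : 0 ≤ wordPoint w := by
  unfold wordPoint
  positivity

lemma wordPoint_le_one (w : α) : wordPoint w ≤ 1 := by
  refine div_le_one_of_le₀ ?_ (by positivity)
  exact_mod_cast (Fintype.equivFin α w).2.le

lemma le_abs_wordPoint_sub {w w' : α} (h : w ≠ w') :
    1 / (Fintype.card α : ℝ) ≤ |wordPoint w - wordPoint w'| := by
  rw [wordPoint, wordPoint, ← sub_div, abs_div, Nat.abs_cast]
  gcongr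
  have : ((Fintype.equivFin α w : ℕ) : ℤ) - (Fintype.equivFin α w' : ℕ) ≠ 0 := by
    intro h'
    refine h ((Fintype.equivFin α).injective (Fin.ext ?_))
    omega
  exact_mod_cast Int.one_le_abs this

/-- The rows of the decoding matrix: the words are points `(κ, -κ ^ 2 / 2)` on a parabola. -/
def decoding {K : ℕ} (w : α) (k : Coord K) : ℝ :=
  (if k = .inl .num then wordPoint w else 0) + if k = .inl .den then -(wordPoint w ^ 2 / 2) else 0

lemma abs_decoding_le {K : ℕ} (w : α) (k : Coord K) : |decoding w k| ≤ 1 := by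
  have h0 := wordPoint_nonneg w
  have h1 := wordPoint_le_one w
  unfold decoding
  split_ifs with h h' h'
  · exact absurd (h.symm.trans h') (by simp)
  all_goals
    rw [abs_le]
    constructor <;> nlinarith

lemma sum_decoding {K : ℕ} (w : α) (z : Coord K → ℝ) :
    ∑ k, decoding w k * z k =
      wordPoint w * z (.inl .num) - wordPoint w ^ 2 / 2 * z (.inl .den) := by
  simp [decoding, add_mul, Finset.sum_add_distrib, ite_mul, sub_eq_add_neg]

end

section

variable [Fintype α] [DecidableEq α]

section

variable {D : ℕ} {F : Seq α → Seq (Fin D)} {Wdec : Matrix (Fin D) α ℝ}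

lemma nextWord_eq_some {s : List α} {w : α}
    (h : ∀ w', w' ≠ w → score F Wdec s w' < score F Wdec s w) :
    nextWord F Wdec s = some w := by
  have hex : ∃ w, ∀ w', w' ≠ w → score F Wdec s w' < score F Wdec s w := ⟨w, h⟩
  rw [nextWord, dif_pos hex]
  by_contra hne
  have hne' : hex.choose ≠ w := fun h' => hne (by rw [h'])
  exact lt_asymm (h _ hne') (hex.choose_spec _ hne'.symm)

lemma copyError_eq_zero {bos copy : α} {n : ℕ}
    (h : ∀ x : Fin n → Content bos copy, ∀ i < n,
      nextWord F Wdec (prompt x ++ (wordsOf x).take i) = (wordsOf x)[i]?) :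
    copyError bos copy F Wdec n = 0 := by
  have hlen : ∀ x : Fin n → Content bos copy, (wordsOf x).length = n := fun x => by
    simp [wordsOf]
  have hempty : {x : Fin n → Content bos copy |
      generate (nextWord F Wdec) (prompt x) n ≠ some (wordsOf x)} = ∅ := by
    ext x
    have := generate_eq_take (next := nextWord F Wdec) (s := prompt x) (l := wordsOf x)
      (fun i hi => h x i (by rwa [hlen] at hi)) (k := n) (hlen x).ge
    rw [List.take_of_length_le (hlen x).le] at this
    simp [this]
  rw [copyError, hempty, measureReal_empty]

end

/-- The codes of the words in the signal; the special words have the code `0`. -/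
def wordCode (bos copy w : α) : ℝ := if w = bos ∨ w = copy then 0 else wordPoint w

lemma abs_wordCode_le (bos copy w : α) : |wordCode bos copy w| ≤ 1 := by
  unfold wordCode
  split_ifs
  · simp
  · rw [abs_of_nonneg (wordPoint_nonneg w)]
    exact wordPoint_le_one w

/-- The rows of the embedding matrix. -/
def embedding {K : ℕ} (bos copy : α) : Coord K → α → ℝ
  | .inl .word | .inl .wordSucc => wordCode bos copy
  | .inl .bos | .inl .bosSucc => fun w => if w = bos then 1 else 0
  | .inl .cpy | .inl .cpySucc => fun w => if w = copy then 1 else 0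
  | _ => 0

lemma abs_embedding_le {K : ℕ} (bos copy : α) (k : Coord K) (w : α) :
    |embedding bos copy k w| ≤ 1 := by
  have h : ∀ p : Prop, ∀ _ : Decidable p, |if p then (1 : ℝ) else 0| ≤ 1 := by
    intro p _
    split_ifs <;> simp
  rcases k with k | k
  · cases k <;> first | exact abs_wordCode_le bos copy w | exact h _ _ | simp [embedding]
  · simp [embedding]

lemma copySignal_copyText {bos copy : α} {l : List α} {V i : ℕ} (hl : l.length ≤ V)
    (hi : i < l.length) :
    CopySignal V l.length i (textSignal (wordCode bos copy) (copyText bos copy l i)) where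
  le := hl
  lt := hi
  zero := by simp [textSignal_copyText_zero, wordCode]
  rep m h1 h2 := textSignal_copyText_rep _ h1 h2 hi.le
  bound m := by
    unfold textSignal
    cases (copyText bos copy l i)[m]?
    · simp
    · exact abs_wordCode_le _ _ _

lemma isCopyInput_copyText {K : ℕ} {bos copy : α} (hne : bos ≠ copy) {l : List α} (hb : bos ∉ l)
    (hc : copy ∉ l) {i : ℕ} (hi : i < l.length) :
    IsCopyInput (K := K) l.length i (textSignal (wordCode bos copy) (copyText bos copy l i))
      fun t k => ∑ w, embedding bos copy k w * oneHot (copyText bos copy l i) t w := by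
  have hlen := length_copyText (bos := bos) (copy := copy) hi.le
  have hbos : ∀ t, ∑ w, (if w = bos then (1 : ℝ) else 0) * oneHot (copyText bos copy l i) t w =
      if t = l.length + 1 + i then 1 else 0 := by
    intro t
    rw [sum_mul_oneHot _ hlen, backward, textSignal_indicator_bos hne hb, ← ite_and]
    congr 1
    simp only [eq_iff_iff]
    omega
  have hcpy : ∀ t, ∑ w, (if w = copy then (1 : ℝ) else 0) * oneHot (copyText bos copy l i) t w =
      if t = i then 1 else 0 := by
    intro t
    rw [sum_mul_oneHot _ hlen, backward, textSignal_indicator_copy hne hc, ← ite_and]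
    congr 1
    simp only [eq_iff_iff]
    omega
  exact ⟨sum_mul_oneHot _ hlen, sum_mul_oneHot _ hlen, hbos, hbos, hcpy, hcpy⟩

/-- Two blocks of logarithmic size copy all texts of at most `V` words without error. -/
lemma exists_copyError_eq_zero {bos copy : α} (hne : bos ≠ copy) {V K : ℕ} (hK : V + 2 ≤ 2 ^ K)
    (hK' : 2 ^ (K + 1) ≤ 4 * (V + 2)) {L W S : ℕ} {B : ℝ} (hL : L = 3 * (2 * K + 4) + 2)
    (hW : 12 * (14 + (K * 4 + K)) ≤ W) (hS : L * (W * W + W) ≤ S)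
    (hB : 100 * ((V : ℝ) + 2) ^ 2 ≤ B) :
    ∃ F ∈ ssmClass α 2 V (14 + (K * 4 + K)) L W S B,
      ∃ Wdec : Matrix (Fin (14 + (K * 4 + K))) α ℝ, (∀ k w, |Wdec k w| ≤ 1) ∧
        ∀ n ≤ V, copyError bos copy F Wdec n = 0 := by
  subst hL
  rw [← card_coord K]
  have : Nonempty α := ⟨bos⟩
  have hN : 1 ≤ (Fintype.card α : ℝ) := by exact_mod_cast Fintype.card_pos
  have hV : (0 : ℝ) ≤ V := by positivity
  have hB1 : 1 ≤ B := by nlinarith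
  have hB4 : 4 * ((V : ℝ) + 2) ^ 2 ≤ B := by nlinarith
  set y : ℝ := 1 / (4 * Fintype.card α * (V + 2) ^ 2) with hy
  have hy1 : y ≤ 1 := by
    rw [hy, div_le_one (by positivity)]
    nlinarith
  have hyN : y * (V + 2) ^ 2 = 1 / (4 * Fintype.card α) := by
    rw [hy]
    field_simp
  obtain ⟨f₁, f₂, hf₁, hf₂, hret⟩ := exists_retrieval (y := y) (by positivity) hy1 hK hK' hB hW
  obtain ⟨F, hF, hFeq⟩ := exists_mem_ssmClass hB1 (embedding (K := K) bos copy)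
    (fun k w => (abs_embedding_le bos copy k w).trans hB1) (firstFilter V) (secondFilter V)
    (boundedBy_firstFilter hB4) (boundedBy_secondFilter hB4) hf₁ hf₂ hS
  refine ⟨F, hF, fun k w => decoding w ((Fintype.equivFin (Coord K)).symm k),
    fun k w => abs_decoding_le w _, fun n hn => copyError_eq_zero fun x i hi => ?_⟩
  have hlen : (wordsOf x).length = n := by simp [wordsOf]
  have hb : bos ∉ wordsOf x := by
    simp only [wordsOf, List.mem_ofFn, not_exists]
    exact fun j => (x j).2.1
  have hc : copy ∉ wordsOf x := by
    simp only [wordsOf, List.mem_ofFn, not_exists]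
    exact fun j => (x j).2.2
  generalize hlx : wordsOf x = l at hlen hb hc
  have htext : prompt x ++ l.take i = copyText bos copy l i := by rw [prompt, hlx, copyText]
  subst hlen
  have hmem := List.getElem_mem hi
  rw [htext, List.getElem?_eq_getElem hi]
  obtain ⟨hden, hnum⟩ := hret _ i _ _ (copySignal_copyText (bos := bos) (copy := copy) hn hi)
    (isCopyInput_copyText hne hb hc hi)
  have hcode : textSignal (wordCode bos copy) (copyText bos copy l i) (i + 1) = wordPoint l[i] := by
    have h1 : l[i] ≠ bos := fun h => hb (h ▸ hmem)
    have h2 : l[i] ≠ copy := fun h => hc (h ▸ hmem)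
    simp [textSignal, getElem?_copyText_of_lt hi, hi, wordCode, h1, h2]
  rw [hcode, hyN] at hnum
  refine nextWord_eq_some fun w hw => ?_
  simp only [score]
  rw [← (Fintype.equivFin (Coord K)).sum_comp, ← (Fintype.equivFin (Coord K)).sum_comp]
  simp only [Equiv.symm_apply_apply, hFeq, sum_decoding]
  exact parabola_lt (by linarith) hden (le_abs_wordPoint_sub hw.symm) hnum

end

/-! ### Size of the model -/

lemma le_sizeBound {C ε a : ℝ} {V N k : ℕ} (hC : 0 ≤ C) (hN : 3 ≤ N) (hk : k ≤ 42)
    (ha : a ≤ C * (max 1 (Real.log V)) ^ k) : a ≤ sizeBound C ε V N := by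
  have h1 : 1 ≤ (max 1 (Real.log ε⁻¹)) ^ 37 := one_le_pow₀ (le_max_left _ _)
  have h2 : (max 1 (Real.log V)) ^ k ≤ (max 1 (Real.log V)) ^ 42 :=
    pow_le_pow_right₀ (le_max_left _ _) hk
  have h3 : 1 ≤ (Real.log N) ^ 8 := by
    refine one_le_pow₀ ?_
    rw [Real.le_log_iff_exp_le (by positivity)]
    have : (3 : ℝ) ≤ N := by exact_mod_cast hN
    linarith [Real.exp_one_lt_d9]
  have h0 : 0 ≤ (max 1 (Real.log V)) ^ k := by positivity
  calc a ≤ C * 1 * (max 1 (Real.log V)) ^ k * 1 := by rwa [mul_one, mul_one]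
    _ ≤ sizeBound C ε V N := by
      unfold sizeBound
      gcongr

lemma log_add_one_le {V : ℕ} (hV : 1 ≤ V) :
    ((Nat.log 2 (V + 1) + 1 : ℕ) : ℝ) ≤ 4 * max 1 (Real.log V) := by
  have h1 : (2 : ℝ) ^ Nat.log 2 (V + 1) ≤ 2 * V := by
    have : 2 ^ Nat.log 2 (V + 1) ≤ 2 * V :=
      (Nat.pow_log_le_self 2 (by omega)).trans (by omega)
    exact_mod_cast this
  have hV' : (0 : ℝ) < V := by exact_mod_cast hV
  have h2 := Real.log_le_log (by positivity) h1
  rw [Real.log_pow, Real.log_mul (by norm_num) hV'.ne'] at h2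
  have h3 := Real.log_two_gt_d9
  have h4 : (0 : ℝ) ≤ Nat.log 2 (V + 1) := by positivity
  have h5 := le_max_left 1 (Real.log V)
  have h6 := le_max_right 1 (Real.log V)
  push_cast
  by_contra! h
  nlinarith

end

end SSM

end

theorem theorem3p1 :
    ∃ C : ℝ, 0 < C ∧
      ∀ (α : Type*) [Fintype α] [DecidableEq α] (bos copy : α),
        bos ≠ copy → 3 ≤ Fintype.card α →
      ∀ (ε : ℝ) (V : ℕ), 0 < ε → 1 ≤ V →
      ∃ (D L W S : ℕ) (B : ℝ) (F : SSM.Seq α → SSM.Seq (Fin D)) (Wdec : Matrix (Fin D) α ℝ),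
        (D : ℝ) ≤ SSM.sizeBound C ε V (Fintype.card α) ∧
        (L : ℝ) ≤ SSM.sizeBound C ε V (Fintype.card α) ∧
        (W : ℝ) ≤ SSM.sizeBound C ε V (Fintype.card α) ∧
        (S : ℝ) ≤ SSM.sizeBound C ε V (Fintype.card α) ∧
        0 < B ∧ Real.log B ≤ SSM.sizeBound C ε V (Fintype.card α) ∧
        F ∈ SSM.ssmClass α 2 V D L W S B ∧
        (∀ k w, |Wdec k w| ≤ 1) ∧
        ∀ V' ∈ Finset.Icc 1 V, SSM.copyError bos copy F Wdec V' ≤ ε := by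
  refine ⟨10 ^ 7, by norm_num, ?_⟩
  intro α _ _ bos copy hne hN ε V hε hV
  have hKc := SSM.log_add_one_le hV
  -- the number of binary digits of the distances in a window
  set K := Nat.log 2 (V + 1) + 1 with hKdef
  set c := max 1 (Real.log V) with hc
  have hc1 : 1 ≤ c := le_max_left _ _
  have hK : V + 2 ≤ 2 ^ K := Nat.lt_pow_succ_log_self (by norm_num) (V + 1)
  have hK' : 2 ^ (K + 1) ≤ 4 * (V + 2) := by
    have := Nat.pow_log_le_self 2 (show V + 1 ≠ 0 by omega)
    rw [hKdef, pow_succ, pow_succ]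
    omega
  set D := 14 + (K * 4 + K) with hD
  set L := 3 * (2 * K + 4) + 2 with hL
  have hDc : (D : ℝ) ≤ 34 * c := by
    rw [hD]
    push_cast
    linarith
  have hLc : (L : ℝ) ≤ 38 * c := by
    rw [hL]
    push_cast
    linarith
  have hWc : ((12 * D : ℕ) : ℝ) ≤ 408 * c := by
    push_cast
    linarith
  have hSc : ((L * (12 * D * (12 * D) + 12 * D) : ℕ) : ℝ) ≤ 10 ^ 7 * c ^ 3 := by
    rw [Nat.cast_mul L, Nat.cast_add (12 * D * (12 * D)), Nat.cast_mul (12 * D)]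
    calc (L : ℝ) * (((12 * D : ℕ) : ℝ) * ((12 * D : ℕ) : ℝ) + ((12 * D : ℕ) : ℝ))
        ≤ 38 * c * (408 * c * (408 * c) + 408 * c) := by gcongr
      _ ≤ 38 * c * (408 * c * (408 * c) + 408 * c * c) := by
        gcongr
        nlinarith
      _ = 6341136 * c ^ 3 := by ring
      _ ≤ 10 ^ 7 * c ^ 3 := by
        gcongr
        norm_num
  have hV1 : (1 : ℝ) ≤ V := by exact_mod_cast hV
  have hBc : Real.log (100 * ((V : ℝ) + 2) ^ 2) ≤ 902 * c := by
    have h1 : 100 * ((V : ℝ) + 2) ^ 2 ≤ 900 * (V : ℝ) ^ 2 := by nlinarith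
    have h2 := Real.log_le_log (by positivity) h1
    rw [Real.log_mul (x := 900) (by norm_num) (by positivity), Real.log_pow] at h2
    have h3 := Real.log_le_self (show (0 : ℝ) ≤ 900 by norm_num)
    have h4 : Real.log V ≤ c := le_max_right _ _
    push_cast at h2
    linarith
  obtain ⟨F, hF, Wdec, hWdec, herr⟩ := SSM.exists_copyError_eq_zero hne hK hK' hL le_rfl le_rfl
    (le_refl (100 * ((V : ℝ) + 2) ^ 2))
  have hlin : ∀ {a r : ℝ}, a ≤ r * c → r ≤ 10 ^ 7 →
      a ≤ SSM.sizeBound (10 ^ 7) ε V (Fintype.card α) := fun {a r} ha hr =>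
    SSM.le_sizeBound (k := 1) (by norm_num) hN (by norm_num) (by
      rw [pow_one]
      exact ha.trans (by gcongr))
  refine ⟨D, L, 12 * D, _, _, F, Wdec, hlin hDc (by norm_num), hlin hLc (by norm_num),
    hlin hWc (by norm_num), SSM.le_sizeBound (by norm_num) hN (by norm_num) hSc, by positivity,
    hlin hBc (by norm_num), hF, hWdec, ?_⟩
  intro V' hV'
  rw [herr V' (Finset.mem_Icc.1 hV').2]
  exact hε.le
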